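/- Fix $r\in\mathbb N$, a constant $\tau>0$ and compact sets $\mathcal L,\mathcal F\subset\mathbb R^r$. Let $H_\tau(x)=x^2/2$ for $|x|\le\tau$ and $H_\tau(x)=\tau|x|-\tau^2/2$ for $|x|>\tau$. For sample sizes $N,T$ let $\Theta=\Theta_{N,T}$ be the set of all $\theta=(\mathbf L,\mathbf F)$, where $\mathbf L\in\mathbb R^{N\times r}$ has rows $l_i\in\mathcal L$ and $\mathbf F\in\mathbb R^{T\times r}$ has rows $f_t\in\mathcal F$, such that $\mathbf L^\top\mathbf L/N=\mathbf I_r$ and $\frac1T\sum_{t=1}^T f_tf_t^\top$ is diagonal with positive non-increasing diagonal entries. Let $N=N_k\to\infty$ and $T=T_k\to\infty$ along an arbitrary sequence of sample sizes; everything below, including the probability space, may depend on $k$, except $r,\tau,\mathcal L,\mathcal F$ and the constants $\sigma_{0j}$ and $\underline f$. We observe $$Y_{it}=l_{0i}^\top f_{0t}+\epsilon_{it},\qquad 1\le i\le N,\ 1\le t\le T,$$ with a deterministic loading matrix $\mathbf L_0$ with rows $l_{0i}$, a random factor matrix $\mathbf F_0$ with rows $f_{0t}$, and random errors $\epsilon_{it}$.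 Assume: 1. $(\mathbf L_0,\mathbf F_0)\in\Theta$ almost surely, and for $j=1,\dots,r$ the $j$-th diagonal entry of $\frac1T\sum_{t} f_{0t}f_{0t}^\top$ converges in probability to a constant $\sigma_{0j}$, where $\infty>\sigma_{01}>\dots>\sigma_{0r}>0$. 2. Given $\{f_{0t}\}$, the errors $\epsilon_{it}$ are independent across $i$ and $t$. 3. For all $i,t$, $\mathbb E(\epsilon_{it}^2\mid\{f_{0t}\})<\infty$ almost surely, and the conditional law of $\epsilon_{it}$ given $\{f_{0t}\}$ has a density $f_{it}$ that is continuous and symmetric about the origin; and for every compact $C\subset\mathbb R$ there is a constant $\underline f>0$, depending only on $C$, with $f_{it}(u)>\underline f$ for all $u\in C$ and all $i,t$ (and all $k$), almost surely. Let $\widehat\theta=(\widehat{\mathbf L},\widehat{\mathbf F})$ be such that, with probability tending to one, it is a global minimizer over $\Theta$ of $$\theta\mapsto\frac1{TN}\sum_{t=1}^T\sum_{i=1}^N H_\tau\bigl(Y_{it}-l_i^\top f_t\bigr),$$ and let $\widehat{\mathbf S}=\operatorname{sgn}\bigl(\frac1T\sum_{t=1}^T\widehat f_tf_{0t}^\top\bigr)$,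 that is, the diagonal matrix whose $j$-th diagonal entry is $1$ if the $j$-th diagonal entry of $\frac1T\sum_t\widehat f_tf_{0t}^\top$ is $\ge0$ and $-1$ otherwise. Then, with $L=\min\{N,T\}$ and $\|\cdot\|_F$ the Frobenius norm, $$\frac1N\bigl\|\widehat{\mathbf L}-\mathbf L_0\widehat{\mathbf S}\bigr\|_F^2=O_p\Bigl(\frac1L\Bigr)\quad\text{and}\quad\frac1T\bigl\|\widehat{\mathbf F}-\mathbf F_0\widehat{\mathbf S}\bigr\|_F^2=O_p\Bigl(\frac1L\Bigr).$$ -/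

import Mathlib

open Filter Topology MeasureTheory ProbabilityTheory

noncomputable section

namespace HuberFactor

/-- The product (Borel) sigma-algebra on real matrices. -/
instance instMeasurableSpaceMatrix {m n : ℕ} : MeasurableSpace (Matrix (Fin m) (Fin n) ℝ) :=
  inferInstanceAs (MeasurableSpace (Fin m → Fin n → ℝ))

/-- The Huber loss `H_τ`. -/
def huberLoss (τ x : ℝ) : ℝ :=
  if |x| ≤ τ then x ^ 2 / 2 else τ * |x| - τ ^ 2 / 2

/-- The squared Frobenius norm of a real matrix. -/
def frobSq {m n : ℕ} (A : Matrix (Fin m) (Fin n) ℝ) : ℝ :=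
  ∑ i, ∑ j, A i j ^ 2

/-- `(1/n) ∑_t a_t a_tᵀ`, where the `a_t` are the rows of `A`; this is `Aᵀ A / n`. -/
def gram {n r : ℕ} (A : Matrix (Fin n) (Fin r) ℝ) : Matrix (Fin r) (Fin r) ℝ :=
  (n : ℝ)⁻¹ • (A.transpose * A)

/-- The parameter set `Θ`: pairs `θ = (L, F)` of a loading matrix (rows `l_i`) and a factor matrix
(rows `f_t`) with `l_i ∈ 𝓛`, `f_t ∈ 𝓕`, `Lᵀ L / N = I_r`, and `(1/T) ∑_t f_t f_tᵀ` a diagonal matrix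
with positive, non-increasing diagonal entries. -/
def paramSet {r : ℕ} (𝓛 𝓕 : Set (Fin r → ℝ)) (N T : ℕ) :
    Set (Matrix (Fin N) (Fin r) ℝ × Matrix (Fin T) (Fin r) ℝ) :=
  {θ | (∀ i, θ.1 i ∈ 𝓛) ∧ (∀ t, θ.2 t ∈ 𝓕) ∧ gram θ.1 = 1 ∧
    ∃ d : Fin r → ℝ, (∀ j, 0 < d j) ∧ Antitone d ∧ gram θ.2 = Matrix.diagonal d}

/-- The observations `Y_{it} = l_{0i}ᵀ f_{0t} + ε_{it}`. -/
def observations {r N T : ℕ} (L₀ : Matrix (Fin N) (Fin r) ℝ) (F₀ : Matrix (Fin T) (Fin r) ℝ)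
    (e : Fin N × Fin T → ℝ) : Matrix (Fin N) (Fin T) ℝ :=
  Matrix.of fun i t => (∑ j, L₀ i j * F₀ t j) + e (i, t)

/-- The element-wise Huber factor loss `(1/(TN)) ∑_t ∑_i H_τ (Y_{it} - l_iᵀ f_t)`. -/
def huberObjective {r N T : ℕ} (τ : ℝ) (Y : Matrix (Fin N) (Fin T) ℝ)
    (θ : Matrix (Fin N) (Fin r) ℝ × Matrix (Fin T) (Fin r) ℝ) : ℝ :=
  ((T : ℝ) * (N : ℝ))⁻¹ *
    ∑ t : Fin T, ∑ i : Fin N, huberLoss τ (Y i t - ∑ j, θ.1 i j * θ.2 t j)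

/-- `θ` is a global minimizer over `Θ` of the element-wise Huber factor loss with data `Y`. -/
def IsHuberMinimizer {r N T : ℕ} (τ : ℝ) (𝓛 𝓕 : Set (Fin r → ℝ)) (Y : Matrix (Fin N) (Fin T) ℝ)
    (θ : Matrix (Fin N) (Fin r) ℝ × Matrix (Fin T) (Fin r) ℝ) : Prop :=
  θ ∈ paramSet 𝓛 𝓕 N T ∧ IsMinOn (huberObjective τ Y) (paramSet 𝓛 𝓕 N T) θ

/-- `sgn ((1/T) ∑_t f_t f_{0t}ᵀ)`: the diagonal matrix whose `j`-th diagonal entry is the sign,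
in `{1, -1}`, of the `j`-th diagonal entry of `(1/T) ∑_t f_t f_{0t}ᵀ` (the sign of `0` is `1`). -/
def signMatrix {r T : ℕ} (F F₀ : Matrix (Fin T) (Fin r) ℝ) : Matrix (Fin r) (Fin r) ℝ :=
  Matrix.diagonal fun j =>
    if 0 ≤ ((T : ℝ)⁻¹ • (F.transpose * F₀)) j j then (1 : ℝ) else -1

/-- `X_k = O_p(a_k)` as `k → ∞`; the probability spaces may depend on `k`. For a set that is not
measurable, `P k` is the outer measure, so this is the strong reading for such sets. -/
def IsBigOInProb {Ω : ℕ → Type*} [∀ k, MeasurableSpace (Ω k)] (P : ∀ k, Measure (Ω k))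
    (X : ∀ k, Ω k → ℝ) (a : ℕ → ℝ) : Prop :=
  ∀ δ : ℝ, 0 < δ → ∃ M : ℝ, 0 < M ∧
    ∀ᶠ k in atTop, P k {ω | M * a k < |X k ω|} ≤ ENNReal.ofReal δ

/-- `X_k → c` in probability as `k → ∞`; the probability spaces may depend on `k`. -/
def TendstoInProb {Ω : ℕ → Type*} [∀ k, MeasurableSpace (Ω k)] (P : ∀ k, Measure (Ω k))
    (X : ∀ k, Ω k → ℝ) (c : ℝ) : Prop :=
  ∀ δ : ℝ, 0 < δ → Tendsto (fun k => P k {ω | δ ≤ |X k ω - c|}) atTop (𝓝 0)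

/-- The regular conditional distribution of the whole error array `(ε_{it})` given the factors
`{f_{0t}}`, as a kernel in the value of the factor matrix. -/
def condErrorLaw {r N T : ℕ} {Ω : Type*} [MeasurableSpace Ω] (P : Measure Ω) [IsFiniteMeasure P]
    (F₀ : Ω → Matrix (Fin T) (Fin r) ℝ) (e : Ω → Fin N × Fin T → ℝ) :
    Kernel (Matrix (Fin T) (Fin r) ℝ) (Fin N × Fin T → ℝ) :=
  condDistrib e F₀ P

end HuberFactor

end

/-! Put `δ = L̂ F̂ᵀ - L₀ F₀ᵀ`. The true parameter is a competitor, so the loss at the minimizer does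
not exceed the loss at the truth. By convexity, each entry changes the loss by at least `-ψ(ε) δ + c
1{|ε| ≤ τ/2} δ²`, where `ψ` is the score (`huberLoss_sub_ge`, `huberLoss_sub_ge_of_abs_le`);
compactness bounds `|δ|`, which makes `c` a fixed constant. Given the factors, the scores and the
centred indicators are independent, centred and bounded. A net argument with Hoeffding's inequality
gives both arrays operator norm `O(√(N+T))` (`measure_not_bilinBound_le`). Since `δ` has rank at
most `2r` and its entrywise square rank at most `(2r)²`, trace duality (`BilinBound.sum_mul_le`)
bounds both random sums by a multiple of `√(N+T) ‖δ‖`. The density bound keeps the mean of the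
indicators away from zero, so `‖δ‖² ≲ √(N+T) ‖δ‖` (`sqrt_sum_sq_le_of_loss_le`). This holds
uniformly over the parameter set, so no preliminary consistency step is needed. After division by
`√(NT)` the error is `O(L^(-1/2))`. The spectral gaps of the true factors carry this rate over to
the separate factors, up to signs (`exists_factor_perturbation_bound`). -/

namespace HuberFactor

/-! ### Convexity of the Huber loss. -/

/-- The derivative of the Huber loss: truncation to `[-τ, τ]`. -/
noncomputable def huberScore (τ x : ℝ) : ℝ := max (-τ) (min τ x)

lemma abs_huberScore_le {τ : ℝ} (hτ : 0 ≤ τ) (x : ℝ) : |huberScore τ x| ≤ τ := by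
  rw [abs_le, huberScore]
  exact ⟨le_max_left _ _, max_le (by linarith) (min_le_left _ _)⟩

lemma huberScore_neg {τ : ℝ} (hτ : 0 ≤ τ) (x : ℝ) : huberScore τ (-x) = -huberScore τ x := by
  simp only [huberScore, max_def, min_def]
  split_ifs <;> linarith

/-- The loss is the supremum of the lines `s * x - s ^ 2 / 2` over `|s| ≤ τ`, and the score is the
slope attaining it. With `tangent_le_huberLoss` this yields the subgradient inequality. -/
lemma huberLoss_eq_score {τ : ℝ} (hτ : 0 ≤ τ) (x : ℝ) :
    huberLoss τ x = huberScore τ x * x - huberScore τ x ^ 2 / 2 := by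
  unfold huberLoss huberScore
  split_ifs with h
  · rw [abs_le] at h
    rw [min_eq_right h.2, max_eq_right h.1]
    ring
  · push Not at h
    rcases le_or_gt 0 x with hx | hx
    · rw [abs_of_nonneg hx] at h ⊢
      rw [min_eq_left h.le, max_eq_right (by linarith)]
    · rw [abs_of_neg hx] at h ⊢
      rw [min_eq_right (by linarith), max_eq_left (by linarith)]
      ring

lemma tangent_le_huberLoss {τ s : ℝ} (hs : |s| ≤ τ) (y : ℝ) :
    s * y - s ^ 2 / 2 ≤ huberLoss τ y := by
  unfold huberLoss
  split_ifs with h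
  · nlinarith [sq_nonneg (y - s)]
  · push Not at h
    have h1 : s * y ≤ |s| * |y| := by rw [← abs_mul]; exact le_abs_self _
    have h2 : s ^ 2 = |s| ^ 2 := (sq_abs s).symm
    nlinarith [mul_nonneg (sub_nonneg.2 hs) (sub_nonneg.2 h.le), sq_nonneg (τ - |s|)]

/-- Convexity of the Huber loss. -/
lemma huberLoss_sub_ge {τ : ℝ} (hτ : 0 ≤ τ) (x d : ℝ) :
    -huberScore τ x * d ≤ huberLoss τ (x - d) - huberLoss τ x := by
  have := tangent_le_huberLoss (abs_huberScore_le hτ x) (x - d)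
  rw [huberLoss_eq_score hτ x]
  linarith

/-- Local strong convexity of the Huber loss in the quadratic zone. -/
lemma huberLoss_sub_ge_of_abs_le {τ D : ℝ} (hτ : 0 < τ) {x d : ℝ} (hx : |x| ≤ τ / 2)
    (hd : |d| ≤ D) (hD : τ ≤ D) :
    -huberScore τ x * d + τ / (4 * D) * d ^ 2 ≤ huberLoss τ (x - d) - huberLoss τ x := by
  have hD0 : 0 < D := hτ.trans_le hD
  -- The gain over the tangent is `d ^ 2 / 2` while `x - d` stays in the quadratic zone and at least
  -- `τ / 4 * |d|` beyond it. The coefficient `τ / (4 * D)` lies below both.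
  have key : τ / (4 * D) * d ^ 2 ≤ τ / 4 * |d| := by
    rw [div_mul_eq_mul_div, div_le_iff₀ (by positivity), ← sq_abs d]
    nlinarith [mul_nonneg (mul_nonneg hτ.le (abs_nonneg d)) (sub_nonneg.2 hd)]
  have key2 : τ / (4 * D) * d ^ 2 ≤ d ^ 2 / 2 := by
    have : τ / (4 * D) ≤ 1 / 2 := by rw [div_le_div_iff₀ (by positivity) (by norm_num)]; linarith
    nlinarith [sq_nonneg d]
  have hx' := abs_le.1 hx
  have hsc : huberScore τ x = x := by
    unfold huberScore
    rw [min_eq_right (by linarith [hx'.2]), max_eq_right (by linarith [hx'.1])]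
  have h1 : huberLoss τ x = x ^ 2 / 2 := if_pos (by linarith)
  rw [hsc, h1]
  unfold huberLoss
  split_ifs with h
  · nlinarith
  · push Not at h
    rcases le_or_gt 0 (x - d) with hy | hy
    · rw [abs_of_nonneg hy] at h ⊢
      have hdn : d ≤ 0 := by linarith [hx'.2]
      rw [abs_of_nonpos hdn] at key
      nlinarith [mul_nonneg (sub_nonneg.2 (by linarith [hx'.2] : x ≤ τ / 2))
        (sub_nonneg.2 h.le), mul_nonneg (sub_nonneg.2 hx'.2) (sub_nonneg.2 (by linarith [hx'.2] : x ≤ τ)), hx'.1]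
    · rw [abs_of_neg hy] at h ⊢
      have hdn : 0 ≤ d := by linarith [hx'.1]
      rw [abs_of_nonneg hdn] at key
      nlinarith [mul_nonneg (by linarith [hx'.1] : 0 ≤ τ / 2 + x)
        (sub_nonneg.2 h.le), mul_nonneg (by linarith [hx'.1] : 0 ≤ τ / 2 + x) (by linarith [hx'.1] : 0 ≤ τ + x), hx'.2]

/-! ### Half-nets and norms of linear and bilinear forms. -/

section Net

variable {E : Type*} [NormedAddCommGroup E] [NormedSpace ℝ E] [FiniteDimensional ℝ E]

/-- The unit ball of a `d`-dimensional normed space has a `1/2`-net with at most `5 ^ d` points. -/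
lemma exists_half_net (E : Type*) [NormedAddCommGroup E] [NormedSpace ℝ E]
    [FiniteDimensional ℝ E] :
    ∃ s : Finset E, s.card ≤ 5 ^ Module.finrank ℝ E ∧ (∀ c ∈ s, ‖c‖ ≤ 1) ∧
      ∀ x : E, ‖x‖ ≤ 1 → ∃ c ∈ s, ‖x - c‖ ≤ 1 / 2 := by
  classical
  have card_le : ∀ s : Finset E, (∀ c ∈ s, ‖c‖ ≤ 1) →
      (∀ c ∈ s, ∀ d ∈ s, c ≠ d → 1 / 2 ≤ ‖c - d‖) → s.card ≤ 5 ^ Module.finrank ℝ E := by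
    intro s hs hsep
    -- Doubling gives 1-separated points in the ball of radius 2, the normalization of
    -- `Besicovitch.card_le_of_separated`.
    have hinj : Function.Injective fun x : E => (2 : ℝ) • x := smul_right_injective E two_ne_zero
    rw [← Finset.card_image_of_injective s hinj]
    apply Besicovitch.card_le_of_separated
    · intro c hc
      obtain ⟨x, hx, rfl⟩ := Finset.mem_image.1 hc
      rw [norm_smul, Real.norm_ofNat]
      linarith [hs x hx]
    · intro c hc d hd hne
      obtain ⟨x, hx, rfl⟩ := Finset.mem_image.1 hc
      obtain ⟨y, hy, rfl⟩ := Finset.mem_image.1 hd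
      rw [← smul_sub, norm_smul, Real.norm_ofNat]
      linarith [hsep x hx y hy fun h => hne (by rw [h])]
  -- Without a net, every separated set could be enlarged by a point far from it, eventually beyond
  -- `5 ^ d` points.
  by_contra hcon
  push Not at hcon
  have all : ∀ n : ℕ, ∃ s : Finset E, s.card = n ∧ (∀ c ∈ s, ‖c‖ ≤ 1) ∧
      ∀ c ∈ s, ∀ d ∈ s, c ≠ d → 1 / 2 ≤ ‖c - d‖ := by
    intro n
    induction n with
    | zero => exact ⟨∅, by simp⟩
    | succ n ih =>
      obtain ⟨s, hn, h1, h2⟩ := ih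
      obtain ⟨x, hx, hfar⟩ := hcon s (card_le s h1 h2) h1
      have hxs : x ∉ s := fun h => by have := hfar x h; norm_num at this
      refine ⟨insert x s, by rw [Finset.card_insert_of_notMem hxs, hn], ?_, ?_⟩
      · intro c hc
        rcases Finset.mem_insert.1 hc with rfl | hc
        exacts [hx, h1 c hc]
      · intro c hc d hd hne
        rcases Finset.mem_insert.1 hc with hcx | hcs <;>
          rcases Finset.mem_insert.1 hd with hdx | hds
        · exact absurd (hcx.trans hdx.symm) hne
        · rw [hcx]; exact (hfar d hds).le
        · rw [hdx, norm_sub_rev]; exact (hfar c hcs).le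
        · exact h2 c hcs d hds hne
  obtain ⟨s, hn, h1, h2⟩ := all (5 ^ Module.finrank ℝ E + 1)
  have := card_le s h1 h2
  omega

/-- A linear functional bounded by `K` on a `1/2`-net of the unit ball is bounded by `2 K`. -/
lemma le_of_le_on_half_net {s : Set E} (hs : ∀ x : E, ‖x‖ ≤ 1 → ∃ c ∈ s, ‖x - c‖ ≤ 1 / 2)
    (f : E →ₗ[ℝ] ℝ) {K : ℝ} (hK : 0 ≤ K) (hf : ∀ c ∈ s, f c ≤ K) (x : E) :
    f x ≤ 2 * K * ‖x‖ := by
  set g : E →L[ℝ] ℝ := LinearMap.toContinuousLinearMap f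
  have hg : ∀ y, g y = f y := fun _ => rfl
  have h1 : ∀ y : E, ‖y‖ ≤ 1 → g y ≤ K + ‖g‖ / 2 := by
    intro y hy
    obtain ⟨c, hc, hyc⟩ := hs y hy
    have h2 : g y = f c + g (y - c) := by rw [map_sub, hg c]; ring
    have h3 : g (y - c) ≤ ‖g‖ * ‖y - c‖ := (le_abs_self _).trans (g.le_opNorm _)
    nlinarith [hf c hc, norm_nonneg g]
  -- Half of the norm is absorbed on the left. The bound is one-sided, so `-y` supplies the lower
  -- estimate.
  have h2 : ‖g‖ ≤ K + ‖g‖ / 2 := by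
    refine ContinuousLinearMap.opNorm_le_of_unit_norm (by positivity) fun y hy => ?_
    rw [Real.norm_eq_abs, abs_le]
    constructor
    · have := h1 (-y) (by rw [norm_neg, hy])
      rw [map_neg] at this
      linarith
    · exact h1 y hy.le
  calc f x = g x := rfl
    _ ≤ ‖g‖ * ‖x‖ := (le_abs_self _).trans (g.le_opNorm _)
    _ ≤ 2 * K * ‖x‖ := by gcongr; linarith

lemma bilin_le_of_le_on_half_net {E' : Type*} [NormedAddCommGroup E'] [NormedSpace ℝ E']
    [FiniteDimensional ℝ E'] {s : Set E} {s' : Set E'}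
    (hs : ∀ x : E, ‖x‖ ≤ 1 → ∃ c ∈ s, ‖x - c‖ ≤ 1 / 2)
    (hs' : ∀ x : E', ‖x‖ ≤ 1 → ∃ c ∈ s', ‖x - c‖ ≤ 1 / 2)
    (B : E →ₗ[ℝ] E' →ₗ[ℝ] ℝ) {K : ℝ} (hK : 0 ≤ K) (hB : ∀ c ∈ s, ∀ c' ∈ s', B c c' ≤ K)
    (x : E) (y : E') : B x y ≤ 4 * K * ‖x‖ * ‖y‖ := by
  have h1 : ∀ c ∈ s, B c y ≤ 2 * K * ‖y‖ := fun c hc =>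
    le_of_le_on_half_net hs' (B c) hK (hB c hc) y
  have h2 := le_of_le_on_half_net hs (B.flip y) (K := 2 * K * ‖y‖) (by positivity) h1 x
  calc B x y ≤ 2 * (2 * K * ‖y‖) * ‖x‖ := h2
    _ = _ := by ring

end Net

/-! ### Operator norm bounds and low-rank duality. -/

/-- The bilinear form of the array `W` has operator norm at most `K`. -/
def BilinBound {m n : ℕ} (W : Fin m → Fin n → ℝ) (K : ℝ) : Prop :=
  ∀ (u : EuclideanSpace ℝ (Fin m)) (v : EuclideanSpace ℝ (Fin n)),
    ∑ i, ∑ t, W i t * (u i * v t) ≤ K * ‖u‖ * ‖v‖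

/-- The bilinear form attached to an array. -/
noncomputable def arrayForm {m n : ℕ} (W : Fin m → Fin n → ℝ) :
    EuclideanSpace ℝ (Fin m) →ₗ[ℝ] EuclideanSpace ℝ (Fin n) →ₗ[ℝ] ℝ :=
  LinearMap.mk₂ ℝ (fun u v => ∑ i, ∑ t, W i t * (u i * v t))
    (fun u u' v => by
      simp only [PiLp.add_apply, ← Finset.sum_add_distrib]
      exact Finset.sum_congr rfl fun i _ => Finset.sum_congr rfl fun t _ => by ring)
    (fun c u v => by
      simp only [PiLp.smul_apply, smul_eq_mul, Finset.mul_sum]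
      exact Finset.sum_congr rfl fun i _ => Finset.sum_congr rfl fun t _ => by ring)
    (fun u v v' => by
      simp only [PiLp.add_apply, ← Finset.sum_add_distrib]
      exact Finset.sum_congr rfl fun i _ => Finset.sum_congr rfl fun t _ => by ring)
    (fun c u v => by
      simp only [PiLp.smul_apply, smul_eq_mul, Finset.mul_sum]
      exact Finset.sum_congr rfl fun i _ => Finset.sum_congr rfl fun t _ => by ring)

lemma bilinBound_of_half_net {m n : ℕ} {W : Fin m → Fin n → ℝ} {K : ℝ} (hK : 0 ≤ K)
    {s : Set (EuclideanSpace ℝ (Fin m))} {s' : Set (EuclideanSpace ℝ (Fin n))}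
    (hs : ∀ x, ‖x‖ ≤ 1 → ∃ c ∈ s, ‖x - c‖ ≤ 1 / 2)
    (hs' : ∀ x, ‖x‖ ≤ 1 → ∃ c ∈ s', ‖x - c‖ ≤ 1 / 2)
    (h : ∀ u ∈ s, ∀ v ∈ s', ∑ i, ∑ t, W i t * (u i * v t) ≤ K) : BilinBound W (4 * K) :=
  fun u v => bilin_le_of_le_on_half_net hs hs' (arrayForm W) hK h u v

/-- Trace duality for an array of low rank. -/
lemma BilinBound.sum_mul_le {m n : ℕ} {W : Fin m → Fin n → ℝ} {K : ℝ} (hK : 0 ≤ K)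
    (hW : BilinBound W K) {κ : Type*} [Fintype κ] (a : κ → Fin m → ℝ) (b : κ → Fin n → ℝ)
    {A : Fin m → Fin n → ℝ} (hA : ∀ i t, A i t = ∑ k, a k i * b k t) :
    ∑ i, ∑ t, W i t * A i t ≤ Fintype.card κ * K * √(∑ i, ∑ t, A i t ^ 2) := by
  -- An orthonormal basis `u j` of a space containing the columns of `A` replaces the singular value
  -- decomposition: `A = ∑ u j (v j)ᵀ` with `v j = Aᵀ u j`, so `‖v j‖` is at most the Frobenius
  -- norm. The vectors `a`, `b` only limit the rank.
  set S : Submodule ℝ (EuclideanSpace ℝ (Fin m)) :=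
    Submodule.span ℝ (Set.range fun k => WithLp.toLp 2 (a k)) with hS
  set c : Fin n → EuclideanSpace ℝ (Fin m) := fun t => WithLp.toLp 2 fun i => A i t with hc
  have hmem : ∀ t, c t ∈ S := by
    intro t
    have : c t = ∑ k, b k t • WithLp.toLp 2 (a k) := by
      ext i
      simp [hc, hA, mul_comm]
    rw [this]
    exact Submodule.sum_mem _ fun k _ =>
      Submodule.smul_mem _ _ (Submodule.subset_span (Set.mem_range_self k))
  have hcard : Module.finrank ℝ S ≤ Fintype.card κ := finrank_range_le_card _
  set u := stdOrthonormalBasis ℝ S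
  set v : Fin (Module.finrank ℝ S) → EuclideanSpace ℝ (Fin n) := fun j =>
    WithLp.toLp 2 fun t => inner ℝ (u j : EuclideanSpace ℝ (Fin m)) (c t) with hv
  have hrep : ∀ i t, A i t = ∑ j, (u j : EuclideanSpace ℝ (Fin m)) i * v j t := by
    intro i t
    have h1 := congrArg (fun x : S => (x : EuclideanSpace ℝ (Fin m)) i)
      (u.sum_repr' ⟨c t, hmem t⟩)
    simp only [Submodule.coe_sum, Submodule.coe_smul, Submodule.coe_inner] at h1
    have h2 : A i t = c t i := rfl
    rw [h2, ← h1]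
    simp [hv, mul_comm]
  have hunorm : ∀ j, ‖(u j : EuclideanSpace ℝ (Fin m))‖ = 1 := fun j => u.orthonormal.1 j
  have hvnorm : ∀ j, ‖v j‖ ≤ √(∑ i, ∑ t, A i t ^ 2) := by
    intro j
    rw [EuclideanSpace.norm_eq]
    apply Real.sqrt_le_sqrt
    rw [Finset.sum_comm]
    refine Finset.sum_le_sum fun t _ => ?_
    have h1 : ‖v j t‖ ≤ ‖c t‖ := by
      have := norm_inner_le_norm (𝕜 := ℝ) (u j : EuclideanSpace ℝ (Fin m)) (c t)
      rwa [hunorm, one_mul] at this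
    have h2 : ‖c t‖ ^ 2 = ∑ i, A i t ^ 2 := by
      rw [EuclideanSpace.norm_sq_eq]
      simp [hc]
    rw [← h2]
    gcongr
  calc ∑ i, ∑ t, W i t * A i t
      = ∑ j, ∑ i, ∑ t, W i t * ((u j : EuclideanSpace ℝ (Fin m)) i * v j t) := by
        symm
        rw [Finset.sum_comm]
        refine Finset.sum_congr rfl fun i _ => ?_
        rw [Finset.sum_comm]
        refine Finset.sum_congr rfl fun t _ => ?_
        rw [hrep, Finset.mul_sum]
    _ ≤ ∑ _j : Fin (Module.finrank ℝ S), K * √(∑ i, ∑ t, A i t ^ 2) := by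
        refine Finset.sum_le_sum fun j _ => (hW (u j) (v j)).trans ?_
        rw [hunorm, mul_one]
        gcongr
        exact hvnorm j
    _ = Module.finrank ℝ S * K * √(∑ i, ∑ t, A i t ^ 2) := by
        rw [Finset.sum_const, Finset.card_univ, Fintype.card_fin, nsmul_eq_mul, mul_assoc]
    _ ≤ _ := by gcongr

lemma BilinBound.neg {m n : ℕ} {W : Fin m → Fin n → ℝ} {K : ℝ} (hW : BilinBound W K) :
    BilinBound (fun i t => -W i t) K := fun u v => by
  simpa using hW (-u) v

/-- A quadratic lower bound combined with low-rank trace duality: if the loss difference dominates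
`-Ψ δ + c G δ²` where `G = p + W` and both `Ψ`, `W` have small operator norm, then a low-rank
bounded perturbation `δ` which does not increase the loss is small in Frobenius norm. -/
lemma sqrt_sum_sq_le_of_loss_le {m n : ℕ} {κ : Type*} [Fintype κ] {Ψ G p δ : Fin m → Fin n → ℝ}
    {K c p₀ D : ℝ} (hK : 0 ≤ K) (hc : 0 < c) (hp₀ : 0 < p₀) (hD : 0 ≤ D) (hp : ∀ i t, p₀ ≤ p i t)
    (hΨ : BilinBound Ψ K) (hG : BilinBound (fun i t => G i t - p i t) K)
    (a : κ → Fin m → ℝ) (b : κ → Fin n → ℝ) (hδ : ∀ i t, δ i t = ∑ k, a k i * b k t)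
    (hδD : ∀ i t, |δ i t| ≤ D)
    (hloss : ∑ i, ∑ t, (-Ψ i t * δ i t + c * (G i t * δ i t ^ 2)) ≤ 0) :
    √(∑ i, ∑ t, δ i t ^ 2) ≤
      (Fintype.card κ + c * (Fintype.card κ ^ 2 * D)) * K / (c * p₀) := by
  set s := √(∑ i, ∑ t, δ i t ^ 2) with hs
  have hs0 : 0 ≤ s := Real.sqrt_nonneg _
  have hs2 : s ^ 2 = ∑ i, ∑ t, δ i t ^ 2 :=
    Real.sq_sqrt (Finset.sum_nonneg fun i _ => Finset.sum_nonneg fun t _ => sq_nonneg _)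
  have h1 : ∑ i, ∑ t, Ψ i t * δ i t ≤ Fintype.card κ * K * s := hΨ.sum_mul_le hK a b hδ
  have h2 : ∑ i, ∑ t, -(G i t - p i t) * δ i t ^ 2 ≤ (Fintype.card κ ^ 2 * D) * K * s := by
    -- The entrywise square of a sum of rank-one arrays is a sum over pairs of rank-one arrays, so
    -- its rank is at most the square of the original count.
    have h3 := hG.neg.sum_mul_le hK (κ := κ × κ) (fun k i => a k.1 i * a k.2 i)
      (fun k t => b k.1 t * b k.2 t) (A := fun i t => δ i t ^ 2) (by
        intro i t
        rw [sq, hδ, Finset.sum_mul_sum, Fintype.sum_prod_type]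
        exact Finset.sum_congr rfl fun k _ => Finset.sum_congr rfl fun l _ => by ring)
    refine h3.trans ?_
    have h4 : √(∑ i, ∑ t, (δ i t ^ 2) ^ 2) ≤ D * s := by
      rw [← Real.sqrt_sq hD, hs, ← Real.sqrt_mul (sq_nonneg D)]
      apply Real.sqrt_le_sqrt
      simp only [Finset.mul_sum]
      refine Finset.sum_le_sum fun i _ => Finset.sum_le_sum fun t _ => ?_
      rw [sq (δ i t ^ 2)]
      refine mul_le_mul_of_nonneg_right ?_ (sq_nonneg _)
      rw [← sq_abs]
      exact pow_le_pow_left₀ (abs_nonneg _) (hδD i t) 2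
    rw [Fintype.card_prod]
    push_cast
    calc _ ≤ (Fintype.card κ * Fintype.card κ : ℝ) * K * (D * s) := by gcongr
      _ = _ := by ring
  have h5 : c * p₀ * s ^ 2 ≤ c * ∑ i, ∑ t, p i t * δ i t ^ 2 := by
    rw [hs2, mul_assoc, Finset.mul_sum]
    refine mul_le_mul_of_nonneg_left (Finset.sum_le_sum fun i _ => ?_) hc.le
    rw [Finset.mul_sum]
    exact Finset.sum_le_sum fun t _ => mul_le_mul_of_nonneg_right (hp i t) (sq_nonneg _)
  have h6 : c * ∑ i, ∑ t, p i t * δ i t ^ 2 =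
      ∑ i, ∑ t, (-Ψ i t * δ i t + c * (G i t * δ i t ^ 2)) + ∑ i, ∑ t, Ψ i t * δ i t +
        c * ∑ i, ∑ t, -(G i t - p i t) * δ i t ^ 2 := by
    simp only [Finset.mul_sum, ← Finset.sum_add_distrib]
    exact Finset.sum_congr rfl fun i _ => Finset.sum_congr rfl fun t _ => by ring
  have h7 : c * p₀ * s ^ 2 ≤ (Fintype.card κ + c * (Fintype.card κ ^ 2 * D)) * K * s := by
    have := mul_le_mul_of_nonneg_left h2 hc.le
    linarith
  rw [le_div_iff₀ (by positivity)]
  rcases hs0.eq_or_lt with h0 | h0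
  · rw [← h0, zero_mul]; positivity
  · refine le_of_mul_le_mul_right ?_ h0
    linarith

/-! ### Perturbation of the normalized factorization. -/

section Perturbation

open scoped Matrix Matrix.Norms.Frobenius

variable {r n m : ℕ}

lemma frobenius_norm_sq (A : Matrix (Fin m) (Fin n) ℝ) : ‖A‖ ^ 2 = frobSq A := by
  have h0 : 0 ≤ frobSq A :=
    Finset.sum_nonneg fun i _ => Finset.sum_nonneg fun t _ => sq_nonneg _
  rw [Matrix.frobenius_norm_def, ← Real.sqrt_eq_rpow]
  simp only [Real.norm_eq_abs, Real.rpow_two, sq_abs]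
  exact Real.sq_sqrt h0

lemma abs_entry_le_frobenius_norm (A : Matrix (Fin m) (Fin n) ℝ) (i : Fin m) (j : Fin n) :
    |A i j| ≤ ‖A‖ := by
  apply abs_le_of_sq_le_sq _ (norm_nonneg _)
  rw [frobenius_norm_sq]
  calc A i j ^ 2 ≤ ∑ j, A i j ^ 2 :=
        Finset.single_le_sum (f := fun j => A i j ^ 2) (fun _ _ => sq_nonneg _) (Finset.mem_univ j)
    _ ≤ frobSq A := Finset.single_le_sum (f := fun i => ∑ j, A i j ^ 2)
        (fun _ _ => Finset.sum_nonneg fun _ _ => sq_nonneg _) (Finset.mem_univ i)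

lemma frobSq_eq_sum_diag (A : Matrix (Fin m) (Fin n) ℝ) : frobSq A = ∑ j, (Aᵀ * A) j j := by
  unfold frobSq
  rw [Finset.sum_comm]
  exact Finset.sum_congr rfl fun j _ => by simp [Matrix.mul_apply, sq]

lemma diag_transpose_mul_self_nonneg (A : Matrix (Fin m) (Fin n) ℝ) (j : Fin n) :
    0 ≤ (Aᵀ * A) j j := by
  rw [Matrix.mul_apply]
  exact Finset.sum_nonneg fun i _ => by simpa using mul_self_nonneg (A i j)

lemma norm_of_transpose_mul_self_eq_one {U : Matrix (Fin n) (Fin r) ℝ} (hU : Uᵀ * U = 1) :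
    ‖U‖ = √r := by
  rw [← Real.sqrt_sq (norm_nonneg U), frobenius_norm_sq, frobSq_eq_sum_diag, hU]
  simp

/-- `Q - P Pᵀ Q` is the residual of `Q` after projection onto the column space of `P`; its Gram
matrix measures how far the overlap `Pᵀ Q` is from orthogonal. -/
lemma defect_transpose_mul_self {P Q : Matrix (Fin n) (Fin r) ℝ} (hP : Pᵀ * P = 1)
    (hQ : Qᵀ * Q = 1) :
    (Q - P * (Pᵀ * Q))ᵀ * (Q - P * (Pᵀ * Q)) = 1 - (Pᵀ * Q)ᵀ * (Pᵀ * Q) := by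
  have h1 : Pᵀ * (P * (Pᵀ * Q)) = Pᵀ * Q := by rw [← Matrix.mul_assoc, hP, Matrix.one_mul]
  simp only [Matrix.transpose_sub, Matrix.transpose_mul, Matrix.transpose_transpose,
    Matrix.sub_mul, Matrix.mul_sub, hQ, Matrix.mul_assoc, h1]
  abel

lemma sum_sq_overlap_le_one {P Q : Matrix (Fin n) (Fin r) ℝ} (hP : Pᵀ * P = 1)
    (hQ : Qᵀ * Q = 1) (k : Fin r) : ∑ j, (Pᵀ * Q) j k ^ 2 ≤ 1 := by
  have h := diag_transpose_mul_self_nonneg (Q - P * (Pᵀ * Q)) k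
  rw [defect_transpose_mul_self hP hQ, Matrix.sub_apply, Matrix.one_apply_eq,
    Matrix.mul_apply] at h
  simp only [Matrix.transpose_apply (Pᵀ * Q), ← sq] at h
  linarith

lemma frobSq_defect {P Q : Matrix (Fin n) (Fin r) ℝ} (hP : Pᵀ * P = 1) (hQ : Qᵀ * Q = 1) :
    frobSq (Q - P * (Pᵀ * Q)) = ∑ k, (1 - ∑ j, (Pᵀ * Q) j k ^ 2) := by
  rw [frobSq_eq_sum_diag, defect_transpose_mul_self hP hQ]
  refine Finset.sum_congr rfl fun k _ => ?_
  rw [Matrix.sub_apply, Matrix.one_apply_eq, Matrix.mul_apply]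
  simp only [Matrix.transpose_apply (Pᵀ * Q), ← sq]

variable {U U₀ : Matrix (Fin n) (Fin r) ℝ} {G G₀ : Matrix (Fin m) (Fin r) ℝ} {d d₀ : Fin r → ℝ}
  {b η σ : ℝ}

/-- The overlap `O = U₀ᵀ U` solves the Sylvester equation `O d - d₀ O = U₀ᵀ E G + G₀ᵀ Eᵀ U`, because
the cross term `G₀ᵀ G` cancels. Hence `O j k` is small unless `d k` is near `d₀ j`. -/
lemma abs_overlap_mul_sub_le (hU : Uᵀ * U = 1) (hU₀ : U₀ᵀ * U₀ = 1)
    (hG : Gᵀ * G = Matrix.diagonal d) (hG₀ : G₀ᵀ * G₀ = Matrix.diagonal d₀) (hGb : ‖G‖ ≤ b)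
    (hG₀b : ‖G₀‖ ≤ b) (hη : ‖U * Gᵀ - U₀ * G₀ᵀ‖ ≤ η) (j k : Fin r) :
    |(U₀ᵀ * U) j k * (d k - d₀ j)| ≤ 2 * √r * b * η := by
  have hη0 : 0 ≤ η := (norm_nonneg _).trans hη
  set E := U * Gᵀ - U₀ * G₀ᵀ with hE
  have h1 : U₀ᵀ * E * G + G₀ᵀ * Eᵀ * U = U₀ᵀ * U * Matrix.diagonal d -
      Matrix.diagonal d₀ * (U₀ᵀ * U) := by
    have e1 : U₀ᵀ * E * G = U₀ᵀ * U * (Gᵀ * G) - (U₀ᵀ * U₀) * (G₀ᵀ * G) := by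
      rw [hE]; simp only [Matrix.mul_sub, Matrix.sub_mul, Matrix.mul_assoc]
    have e2 : G₀ᵀ * Eᵀ * U = G₀ᵀ * G * (Uᵀ * U) - (G₀ᵀ * G₀) * (U₀ᵀ * U) := by
      rw [hE]
      simp only [Matrix.mul_sub, Matrix.sub_mul, Matrix.mul_assoc, Matrix.transpose_sub,
        Matrix.transpose_mul, Matrix.transpose_transpose]
    rw [e1, e2, hU, hU₀, hG, hG₀]
    simp
  have h2 : (U₀ᵀ * U) j k * (d k - d₀ j) = (U₀ᵀ * E * G + G₀ᵀ * Eᵀ * U) j k := by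
    rw [h1, Matrix.sub_apply, Matrix.mul_diagonal, Matrix.diagonal_mul]
    ring
  rw [h2]
  refine (abs_entry_le_frobenius_norm _ j k).trans ?_
  have n1 : ‖U₀ᵀ * E * G‖ ≤ √r * η * b := by
    refine (Matrix.frobenius_norm_mul _ _).trans (mul_le_mul ?_ hGb (norm_nonneg _) (by positivity))
    refine (Matrix.frobenius_norm_mul _ _).trans ?_
    rw [Matrix.frobenius_norm_transpose, norm_of_transpose_mul_self_eq_one hU₀]
    gcongr
  have n2 : ‖G₀ᵀ * Eᵀ * U‖ ≤ b * η * √r := by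
    have hb : 0 ≤ b := (norm_nonneg _).trans hGb
    refine (Matrix.frobenius_norm_mul _ _).trans ?_
    rw [norm_of_transpose_mul_self_eq_one hU]
    refine mul_le_mul_of_nonneg_right ?_ (Real.sqrt_nonneg _)
    refine (Matrix.frobenius_norm_mul _ _).trans ?_
    rw [Matrix.frobenius_norm_transpose, Matrix.frobenius_norm_transpose]
    gcongr
  calc _ ≤ ‖U₀ᵀ * E * G‖ + ‖G₀ᵀ * Eᵀ * U‖ := norm_add_le _ _
    _ ≤ √r * η * b + b * η * √r := add_le_add n1 n2
    _ = _ := by ring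

/-- The projection `1 - U Uᵀ` annihilates `U Gᵀ`, so on `U₀ G₀ᵀ` it acts as on `-E`. Multiplying by
`G₀` produces `d₀`, which is divided out by `σ ≤ d₀`. -/
lemma norm_defect_le (hU : Uᵀ * U = 1) (hσ : 0 < σ) (hd₀ : ∀ j, σ ≤ d₀ j)
    (hG₀ : G₀ᵀ * G₀ = Matrix.diagonal d₀) (hG₀b : ‖G₀‖ ≤ b)
    (hη : ‖U * Gᵀ - U₀ * G₀ᵀ‖ ≤ η) : ‖U₀ - U * (Uᵀ * U₀)‖ ≤ (1 + r) * b / σ * η := by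
  have hη0 : 0 ≤ η := (norm_nonneg _).trans hη
  set E := U * Gᵀ - U₀ * G₀ᵀ with hE
  set X := U₀ - U * (Uᵀ * U₀) with hX
  have h1 : X * Matrix.diagonal d₀ = (U * (Uᵀ * E) - E) * G₀ := by
    have h3 : Uᵀ * (U * Gᵀ) = Gᵀ := by rw [← Matrix.mul_assoc, hU, Matrix.one_mul]
    rw [← hG₀, hX, hE]
    simp only [Matrix.mul_sub, Matrix.sub_mul, h3, Matrix.mul_assoc]
    abel
  have h2 : ‖X * Matrix.diagonal d₀‖ ≤ (1 + r) * b * η := by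
    rw [h1]
    refine (Matrix.frobenius_norm_mul _ _).trans ?_
    have h3 : ‖U * (Uᵀ * E) - E‖ ≤ (1 + r) * η := by
      refine (norm_sub_le _ _).trans ?_
      have h4 : ‖U * (Uᵀ * E)‖ ≤ √r * (√r * η) := by
        refine (Matrix.frobenius_norm_mul _ _).trans ?_
        rw [norm_of_transpose_mul_self_eq_one hU]
        refine mul_le_mul_of_nonneg_left ?_ (Real.sqrt_nonneg _)
        refine (Matrix.frobenius_norm_mul _ _).trans ?_
        rw [Matrix.frobenius_norm_transpose, norm_of_transpose_mul_self_eq_one hU]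
        gcongr
      have h5 : √(r : ℝ) * (√r * η) = r * η := by
        rw [← mul_assoc, Real.mul_self_sqrt (Nat.cast_nonneg r)]
      linarith
    calc _ ≤ (1 + r) * η * b := mul_le_mul h3 hG₀b (norm_nonneg _) (by positivity)
      _ = _ := by ring
  have h3 : σ * ‖X‖ ≤ ‖X * Matrix.diagonal d₀‖ := by
    apply le_of_sq_le_sq _ (norm_nonneg _)
    rw [mul_pow, frobenius_norm_sq, frobenius_norm_sq]
    unfold frobSq
    simp only [Finset.mul_sum]
    refine Finset.sum_le_sum fun i _ => Finset.sum_le_sum fun j _ => ?_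
    rw [Matrix.mul_diagonal, mul_pow, mul_comm]
    gcongr
    exact hd₀ j
  rw [div_mul_eq_mul_div, le_div_iff₀ hσ]
  linarith

/-- An almost orthogonal matrix which almost intertwines two decreasing diagonal matrices, one of
them with spectral gaps, is almost diagonal. -/
lemma one_sub_sq_diag_le {O : Matrix (Fin r) (Fin r) ℝ} {g ζ ξ : ℝ} (hg : 0 < g)
    (hd : Antitone d) (hgap : ∀ i j, i < j → g ≤ d₀ i - d₀ j)
    (hζ : ∀ j k, |O j k * (d k - d₀ j)| ≤ ζ) (hcol : ∀ k, 1 - ∑ j, O j k ^ 2 ≤ ξ)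
    (hrow : ∀ j, ∑ k, O j k ^ 2 ≤ 1) (hsmall : ξ + r * (4 * ζ / g) ^ 2 < 1 / 2) (k : Fin r) :
    1 - O k k ^ 2 ≤ ξ + r * (4 * ζ / g) ^ 2 := by
  have entry : ∀ j k, g / 4 ≤ |d k - d₀ j| → O j k ^ 2 ≤ (4 * ζ / g) ^ 2 := by
    intro j k h
    rw [← sq_abs]
    refine pow_le_pow_left₀ (abs_nonneg _) ?_ 2
    rw [le_div_iff₀ hg]
    have := hζ j k
    rw [abs_mul] at this
    nlinarith [abs_nonneg (O j k)]
  -- If `d k` were far from every `d₀ j`, the whole `k`-th column of `O` would be small, against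
  -- `hcol`.
  have hex : ∀ k, ∃ j, |d k - d₀ j| < g / 4 := by
    intro k
    by_contra! hcon
    have h1 : ∑ j, O j k ^ 2 ≤ r * (4 * ζ / g) ^ 2 := by
      simpa using Finset.sum_le_sum fun j (_ : j ∈ Finset.univ) => entry j k (hcon j)
    linarith [hcol k]
  choose π hπ using hex
  have hsep : ∀ j k, j ≠ π k → g / 4 ≤ |d k - d₀ j| := by
    intro j k hne
    have h1 := abs_lt.1 (hπ k)
    rcases lt_or_gt_of_ne hne with h | h
    · have := hgap _ _ h
      rw [abs_sub_comm]
      exact le_trans (by linarith [h1.1, h1.2]) (le_abs_self _)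
    · have := hgap _ _ h
      exact le_trans (by linarith [h1.1, h1.2]) (le_abs_self _)
  have hdiag : ∀ k, 1 - O (π k) k ^ 2 ≤ ξ + r * (4 * ζ / g) ^ 2 := by
    intro k
    have h1 : ∑ j, O j k ^ 2 ≤ O (π k) k ^ 2 + r * (4 * ζ / g) ^ 2 := by
      rw [← Finset.add_sum_erase _ _ (Finset.mem_univ (π k))]
      gcongr
      calc ∑ j ∈ Finset.univ.erase (π k), O j k ^ 2
          ≤ ∑ _j ∈ Finset.univ.erase (π k), (4 * ζ / g) ^ 2 :=
            Finset.sum_le_sum fun j hj => entry j k (hsep j k (Finset.ne_of_mem_erase hj))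
        _ ≤ ∑ _j : Fin r, (4 * ζ / g) ^ 2 :=
            Finset.sum_le_sum_of_subset_of_nonneg (Finset.subset_univ _) fun _ _ _ => sq_nonneg _
        _ = r * (4 * ζ / g) ^ 2 := by simp
    linarith [hcol k]
  -- The matching `π` is monotone by the ordering of `d` and the gaps of `d₀`. It is injective since
  -- one row cannot hold two entries whose squares exceed `1 / 2`. A strictly monotone self-map of
  -- `Fin r` is the identity.
  have hmono : Monotone π := by
    intro k k' hk
    by_contra! hlt
    have h1 := abs_lt.1 (hπ k)
    have h2 := abs_lt.1 (hπ k')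
    linarith [hgap _ _ hlt, hd hk, h1.1, h1.2, h2.1, h2.2]
  have hinj : Function.Injective π := by
    intro k k' h
    by_contra hne
    have h1 : O (π k) k ^ 2 + O (π k) k' ^ 2 ≤ ∑ l, O (π k) l ^ 2 := by
      rw [← Finset.sum_pair (f := fun l => O (π k) l ^ 2) hne]
      exact Finset.sum_le_sum_of_subset_of_nonneg (Finset.subset_univ _) fun _ _ _ => sq_nonneg _
    have h2 := hdiag k
    have h3 := hdiag k'
    rw [← h] at h3
    linarith [hrow (π k)]
  have hid : π k = k :=
    le_antisymm (hmono.strictMono_of_injective hinj).apply_le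
      (hmono.strictMono_of_injective hinj).le_apply
  have := hdiag k
  rwa [hid] at this

/-- Each column contributes `2 - 2 |O k k|`, and `1 - |O k k| ≤ 1 - O k k ^ 2` because `|O k k| ≤
1`. -/
lemma frobSq_sub_mul_diagonal_le (hU : Uᵀ * U = 1) (hU₀ : U₀ᵀ * U₀ = 1) {ξ : ℝ}
    (h : ∀ k, 1 - (U₀ᵀ * U) k k ^ 2 ≤ ξ) {s : Fin r → ℝ} (hs : ∀ k, s k ^ 2 = 1)
    (hsO : ∀ k, s k * (U₀ᵀ * U) k k = |(U₀ᵀ * U) k k|) :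
    frobSq (U - U₀ * Matrix.diagonal s) ≤ 2 * r * ξ := by
  have h1 : ∀ k, ((U - U₀ * Matrix.diagonal s)ᵀ * (U - U₀ * Matrix.diagonal s)) k k =
      2 - 2 * |(U₀ᵀ * U) k k| := by
    intro k
    have e0 : ∑ i, U i k ^ 2 = 1 := by
      simpa [Matrix.mul_apply, sq] using congrFun (congrFun hU k) k
    have e1 : ∑ i, U₀ i k ^ 2 = 1 := by
      simpa [Matrix.mul_apply, sq] using congrFun (congrFun hU₀ k) k
    have e2 : (U₀ᵀ * U) k k = ∑ i, U₀ i k * U i k := by simp [Matrix.mul_apply]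
    rw [Matrix.mul_apply]
    simp only [Matrix.transpose_apply (U - U₀ * Matrix.diagonal s), Matrix.sub_apply,
      Matrix.mul_diagonal]
    calc ∑ i, (U i k - U₀ i k * s k) * (U i k - U₀ i k * s k)
        = ∑ i, U i k ^ 2 - 2 * (s k * ∑ i, U₀ i k * U i k) + s k ^ 2 * ∑ i, U₀ i k ^ 2 := by
          simp only [Finset.mul_sum, ← Finset.sum_sub_distrib, ← Finset.sum_add_distrib]
          exact Finset.sum_congr rfl fun i _ => by ring
      _ = _ := by rw [e0, e1, ← e2, hsO, hs]; ring
  rw [frobSq_eq_sum_diag]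
  calc _ ≤ ∑ _k : Fin r, 2 * ξ := by
        refine Finset.sum_le_sum fun k _ => ?_
        rw [h1]
        have hk := h k
        rw [← sq_abs] at hk
        have hle : |(U₀ᵀ * U) k k| ≤ 1 := by
          rw [abs_le_one_iff_mul_self_le_one, ← sq]
          exact (Finset.single_le_sum (f := fun j => (U₀ᵀ * U) j k ^ 2)
            (fun _ _ => sq_nonneg _) (Finset.mem_univ k)).trans (sum_sq_overlap_le_one hU₀ hU k)
        nlinarith [abs_nonneg ((U₀ᵀ * U) k k)]
    _ = _ := by simp; ring

/-- Perturbation of the normalized rank-`r` factorization `A₀ = U₀ G₀ᵀ`: the factors of a nearby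
matrix of the same form are close to `U₀`, `G₀`, up to signs read off from `Gᵀ G₀`. -/
theorem exists_factor_perturbation_bound (r : ℕ) {b σ g : ℝ} (hb : 0 ≤ b) (hσ : 0 < σ)
    (hg : 0 < g) : ∃ C η₀ : ℝ, 0 < C ∧ 0 < η₀ ∧ ∀ {n m : ℕ} {U U₀ : Matrix (Fin n) (Fin r) ℝ}
      {G G₀ : Matrix (Fin m) (Fin r) ℝ} {d d₀ : Fin r → ℝ} {η : ℝ}, Uᵀ * U = 1 → U₀ᵀ * U₀ = 1 →
      Gᵀ * G = Matrix.diagonal d → G₀ᵀ * G₀ = Matrix.diagonal d₀ → ‖G‖ ≤ b → ‖G₀‖ ≤ b →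
      Antitone d → (∀ j, σ ≤ d₀ j) → (∀ i j, i < j → g ≤ d₀ i - d₀ j) →
      ‖U * Gᵀ - U₀ * G₀ᵀ‖ ≤ η → η ≤ η₀ → ∀ s : Fin r → ℝ,
      (∀ k, s k = if 0 ≤ (Gᵀ * G₀) k k then 1 else -1) →
      ‖U - U₀ * Matrix.diagonal s‖ ≤ C * η ∧ ‖G - G₀ * Matrix.diagonal s‖ ≤ C * η := by
  set q : ℝ := ((1 + r) * b / σ) ^ 2 + r * (4 * (2 * √r * b) / g) ^ 2 with hq
  have hq0 : 0 ≤ q := by positivity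
  set c := √(2 * r * q) with hc
  have hc0 : 0 ≤ c := Real.sqrt_nonneg _
  set c' := √r + b * √r * c with hc'
  have hc'0 : 0 ≤ c' := by positivity
  -- The first smallness condition serves `one_sub_sq_diag_le`; the second makes the signs of `Gᵀ
  -- G₀` agree with those of the overlap.
  obtain ⟨η₀, hη₀, hη₀1, hη₀2⟩ : ∃ η₀ : ℝ, 0 < η₀ ∧ q * η₀ ^ 2 < 1 / 2 ∧ c' * η₀ * b < σ := by
    have t1 : Tendsto (fun x : ℝ => q * x ^ 2) (𝓝[>] 0) (𝓝 0) := by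
      refine Tendsto.mono_left ?_ nhdsWithin_le_nhds
      exact (Continuous.tendsto' (by fun_prop) 0 0 (by simp))
    have t2 : Tendsto (fun x : ℝ => c' * x * b) (𝓝[>] 0) (𝓝 0) := by
      refine Tendsto.mono_left ?_ nhdsWithin_le_nhds
      exact (Continuous.tendsto' (by fun_prop) 0 0 (by simp))
    obtain ⟨x, h1, h2, h3⟩ := ((t1.eventually_lt_const (by norm_num : (0:ℝ) < 1 / 2)).and
      ((t2.eventually_lt_const hσ).and self_mem_nhdsWithin)).exists
    exact ⟨x, h3, h1, h2⟩
  refine ⟨max 1 (max c c'), η₀, by positivity, hη₀, ?_⟩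
  intro n m U U₀ G G₀ d d₀ η hU hU₀ hG hG₀ hGb hG₀b hd hd₀ hgap hη hηη₀ s hs
  have hη0 : 0 ≤ η := (norm_nonneg _).trans hη
  have hdef := norm_defect_le hU hσ hd₀ hG₀ hG₀b hη
  have hrow : ∀ j, ∑ k, (U₀ᵀ * U) j k ^ 2 ≤ 1 := by
    intro j
    have h1 := sum_sq_overlap_le_one hU hU₀ j
    have h2 : (Uᵀ * U₀) = (U₀ᵀ * U)ᵀ := by simp
    rw [h2] at h1
    exact h1
  have hcol : ∀ k, 1 - ∑ j, (U₀ᵀ * U) j k ^ 2 ≤ ((1 + r) * b / σ * η) ^ 2 := by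
    intro k
    have h1 : frobSq (U₀ - U * (Uᵀ * U₀)) ≤ ((1 + r) * b / σ * η) ^ 2 := by
      rw [← frobenius_norm_sq]
      exact pow_le_pow_left₀ (norm_nonneg _) hdef 2
    rw [frobSq_defect hU hU₀] at h1
    -- The total defect is the same for `O` and its transpose. All column terms are nonnegative, so
    -- each is at most the total.
    have h2 : ∑ k, (1 - ∑ j, (Uᵀ * U₀) j k ^ 2) = ∑ k, (1 - ∑ j, (U₀ᵀ * U) j k ^ 2) := by
      have h3 : (Uᵀ * U₀) = (U₀ᵀ * U)ᵀ := by simp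
      rw [h3, Finset.sum_sub_distrib, Finset.sum_sub_distrib, Finset.sum_comm]
      rfl
    rw [h2] at h1
    exact (Finset.single_le_sum (f := fun k => 1 - ∑ j, (U₀ᵀ * U) j k ^ 2)
      (fun k _ => sub_nonneg.2 (sum_sq_overlap_le_one hU₀ hU k)) (Finset.mem_univ k)).trans h1
  have hqη : ((1 + r) * b / σ * η) ^ 2 + r * (4 * (2 * √r * b * η) / g) ^ 2 = q * η ^ 2 := by
    rw [hq]; ring
  have hdiag : ∀ k, 1 - (U₀ᵀ * U) k k ^ 2 ≤ q * η ^ 2 := by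
    intro k
    rw [← hqη]
    refine one_sub_sq_diag_le hg hd hgap
      (abs_overlap_mul_sub_le hU hU₀ hG hG₀ hGb hG₀b hη) hcol hrow ?_ k
    rw [hqη]
    refine lt_of_le_of_lt ?_ hη₀1
    gcongr
  set s' : Fin r → ℝ := fun k => if 0 ≤ (U₀ᵀ * U) k k then 1 else -1 with hs'
  have hs'sq : ∀ k, s' k ^ 2 = 1 := by
    intro k; simp only [hs']; split_ifs <;> norm_num
  have hs'O : ∀ k, s' k * (U₀ᵀ * U) k k = |(U₀ᵀ * U) k k| := by
    intro k
    simp only [hs']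
    split_ifs with h
    · rw [one_mul, abs_of_nonneg h]
    · rw [abs_of_neg (not_le.1 h)]; ring
  have hUbd : ‖U - U₀ * Matrix.diagonal s'‖ ≤ c * η := by
    apply le_of_sq_le_sq _ (by positivity)
    rw [frobenius_norm_sq, mul_pow, hc, Real.sq_sqrt (by positivity)]
    refine (frobSq_sub_mul_diagonal_le hU hU₀ hdiag hs'sq hs'O).trans (le_of_eq (by ring))
  have hGbd : ‖G - G₀ * Matrix.diagonal s'‖ ≤ c' * η := by
    have h1 : G - G₀ * Matrix.diagonal s' =
        (U * Gᵀ - U₀ * G₀ᵀ)ᵀ * U + G₀ * (U₀ᵀ * (U - U₀ * Matrix.diagonal s')) := by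
      have e1 : U₀ᵀ * (U₀ * Matrix.diagonal s') = Matrix.diagonal s' := by
        rw [← Matrix.mul_assoc, hU₀, Matrix.one_mul]
      simp only [Matrix.transpose_sub, Matrix.transpose_mul, Matrix.transpose_transpose,
        Matrix.sub_mul, Matrix.mul_sub, Matrix.mul_assoc, hU, e1, Matrix.mul_one]
      abel
    rw [h1]
    have n1 : ‖(U * Gᵀ - U₀ * G₀ᵀ)ᵀ * U‖ ≤ η * √r := by
      refine (Matrix.frobenius_norm_mul _ _).trans ?_
      rw [Matrix.frobenius_norm_transpose, norm_of_transpose_mul_self_eq_one hU]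
      gcongr
    have n2 : ‖G₀ * (U₀ᵀ * (U - U₀ * Matrix.diagonal s'))‖ ≤ b * (√r * (c * η)) := by
      refine (Matrix.frobenius_norm_mul _ _).trans ?_
      refine mul_le_mul hG₀b ?_ (norm_nonneg _) hb
      refine (Matrix.frobenius_norm_mul _ _).trans ?_
      rw [Matrix.frobenius_norm_transpose, norm_of_transpose_mul_self_eq_one hU₀]
      gcongr
    calc _ ≤ _ := norm_add_le _ _
      _ ≤ η * √r + b * (√r * (c * η)) := add_le_add n1 n2
      _ = c' * η := by rw [hc']; ring
  -- The diagonal of `Gᵀ G₀` lies within less than `σ ≤ d₀ k` of `s' k * d₀ k`, so it is nonzero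
  -- with the sign `s' k` and the convention at zero plays no role here.
  have hss : s = s' := by
    funext k
    have h1 : ((G - G₀ * Matrix.diagonal s')ᵀ * G₀) k k = (Gᵀ * G₀) k k - s' k * d₀ k := by
      rw [Matrix.transpose_sub, Matrix.transpose_mul, Matrix.diagonal_transpose, Matrix.sub_mul,
        Matrix.mul_assoc, hG₀, Matrix.sub_apply, Matrix.diagonal_mul_diagonal,
        Matrix.diagonal_apply_eq]
    have h2 : |(Gᵀ * G₀) k k - s' k * d₀ k| < σ := by
      rw [← h1]
      refine lt_of_le_of_lt ((abs_entry_le_frobenius_norm _ k k).trans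
        (Matrix.frobenius_norm_mul _ _)) ?_
      rw [Matrix.frobenius_norm_transpose]
      refine lt_of_le_of_lt (mul_le_mul hGbd hG₀b (norm_nonneg _) (by positivity)) ?_
      refine lt_of_le_of_lt ?_ hη₀2
      gcongr
    have h3 := abs_lt.1 h2
    have h4 := hd₀ k
    rw [hs k]
    by_cases hO : 0 ≤ (U₀ᵀ * U) k k
    · have e : s' k = 1 := by simp only [hs']; rw [if_pos hO]
      rw [e] at h3 ⊢
      rw [if_pos (by linarith [h3.1])]
    · have e : s' k = -1 := by simp only [hs']; rw [if_neg hO]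
      rw [e] at h3 ⊢
      rw [if_neg (by linarith [h3.2])]
  rw [hss]
  constructor
  · exact hUbd.trans (by gcongr; exact (le_max_left _ _).trans (le_max_right _ _))
  · exact hGbd.trans (by gcongr; exact (le_max_right _ _).trans (le_max_right _ _))

end Perturbation

/-! ### Operator norms of conditionally independent arrays. -/

section Concentration

variable {Ω : Type*} [MeasurableSpace Ω] {m n : ℕ}

/-- Hoeffding's inequality for the bilinear form of an array with independent, centred and bounded
entries. -/
lemma measure_bilin_ge_le {μ : Measure Ω} [IsProbabilityMeasure μ]
    {X : Fin m × Fin n → Ω → ℝ} {B : ℝ} (hB : 0 < B) (hX : ∀ p, Measurable (X p))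
    (hind : iIndepFun X μ) (hXB : ∀ p ω, |X p ω| ≤ B) (hmean : ∀ p, ∫ ω, X p ω ∂μ = 0)
    (u : EuclideanSpace ℝ (Fin m)) (v : EuclideanSpace ℝ (Fin n)) (hu : ‖u‖ ≤ 1) (hv : ‖v‖ ≤ 1)
    {s : ℝ} (hs : 0 ≤ s) :
    μ {ω | s ≤ ∑ i, ∑ t, X (i, t) ω * (u i * v t)} ≤
      ENNReal.ofReal (Real.exp (-s ^ 2 / (2 * B ^ 2))) := by
  have h1 : ∀ p ∈ (Finset.univ : Finset (Fin m × Fin n)),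
      HasSubgaussianMGF (fun ω => (u p.1 * v p.2) * X p ω)
        (.mk ((u p.1 * v p.2) ^ 2) (sq_nonneg _) * (‖B - (-B)‖₊ / 2) ^ 2) μ := fun p _ =>
    (hasSubgaussianMGF_of_mem_Icc_of_integral_eq_zero (hX p).aemeasurable
      (ae_of_all _ fun ω => abs_le.1 (hXB p ω)) (hmean p)).const_mul _
  have hind' : iIndepFun (fun p ω => (u p.1 * v p.2) * X p ω) μ :=
    hind.comp (fun p y => (u p.1 * v p.2) * y) fun p => by fun_prop
  have h2 := HasSubgaussianMGF.sum_of_iIndepFun hind' h1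
  set C : NNReal := ∑ p : Fin m × Fin n,
    (NNReal.mk ((u p.1 * v p.2) ^ 2) (sq_nonneg _) * (‖B - (-B)‖₊ / 2) ^ 2) with hC
  -- The variance proxies `(u i * v t) ^ 2 * B ^ 2` add up to `‖u‖ ^ 2 * ‖v‖ ^ 2 * B ^ 2`.
  have hCle : (C : ℝ) ≤ B ^ 2 := by
    have hBB : ‖B - -B‖ / 2 = B := by
      rw [Real.norm_eq_abs, abs_of_pos (by linarith)]
      ring
    have h3 : (C : ℝ) = (‖u‖ ^ 2 * ‖v‖ ^ 2) * B ^ 2 := by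
      rw [hC]
      push_cast
      rw [← Finset.sum_mul, hBB, EuclideanSpace.real_norm_sq_eq, EuclideanSpace.real_norm_sq_eq,
        Finset.sum_mul_sum, Fintype.sum_prod_type]
      congr 1
      exact Finset.sum_congr rfl fun i _ => Finset.sum_congr rfl fun t _ => mul_pow _ _ _
    rw [h3]
    have h4 : ‖u‖ ^ 2 * ‖v‖ ^ 2 ≤ 1 :=
      mul_le_one₀ (pow_le_one₀ (norm_nonneg _) hu) (by positivity)
        (pow_le_one₀ (norm_nonneg _) hv)
    nlinarith [sq_nonneg B]
  have h5 : HasSubgaussianMGF (fun ω => ∑ p : Fin m × Fin n, (u p.1 * v p.2) * X p ω)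
      (.mk (B ^ 2) (sq_nonneg B)) μ :=
    ⟨h2.integrable_exp_mul, fun t => (h2.mgf_le t).trans (by
      apply Real.exp_le_exp.2
      have : (C : ℝ) * t ^ 2 ≤ B ^ 2 * t ^ 2 := by gcongr
      change (C : ℝ) * t ^ 2 / 2 ≤ B ^ 2 * t ^ 2 / 2
      linarith)⟩
  have h6 := h5.measure_ge_le hs
  rw [measureReal_def] at h6
  have h7 : {ω | s ≤ ∑ i, ∑ t, X (i, t) ω * (u i * v t)} =
      {ω | s ≤ ∑ p : Fin m × Fin n, (u p.1 * v p.2) * X p ω} := by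
    ext ω
    simp only [Set.mem_ofPred_eq, Fintype.sum_prod_type, mul_comm]
  rw [h7]
  exact (ENNReal.le_ofReal_iff_toReal_le (measure_ne_top _ _) (Real.exp_nonneg _)).2 h6

variable {α : Type*} [MeasurableSpace α]

/-- Given `F`, let the entries of an array be independent, centred and bounded by `B`. Then its
operator norm is at most `16 B √(m + n)`, up to an exponentially small probability. -/
lemma measure_not_bilinBound_le {P : Measure Ω} [IsProbabilityMeasure P] {F : Ω → α}
    (hF : Measurable F) {e : Ω → Fin m × Fin n → ℝ} (he : Measurable e)
    {W : Fin m × Fin n → α → (Fin m × Fin n → ℝ) → ℝ}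
    (hW : ∀ p, Measurable fun z : α × (Fin m × Fin n → ℝ) => W p z.1 z.2) {B : ℝ} (hB : 0 < B)
    (hWB : ∀ p x y, |W p x y| ≤ B)
    (hind : ∀ᵐ x ∂(P.map F), iIndepFun (fun p => W p x) (condDistrib e F P x))
    (hmean : ∀ p, ∀ᵐ x ∂(P.map F), ∫ y, W p x y ∂(condDistrib e F P x) = 0) :
    P {ω | ¬ BilinBound (fun i t => W (i, t) (F ω) (e ω)) (16 * B * √((m + n : ℕ) : ℝ))} ≤
      ENNReal.ofReal (Real.exp (-((m + n : ℕ) : ℝ))) := by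
  obtain ⟨S, hScard, hS1, hS⟩ := exists_half_net (EuclideanSpace ℝ (Fin m))
  obtain ⟨S', hS'card, hS'1, hS'⟩ := exists_half_net (EuclideanSpace ℝ (Fin n))
  rw [finrank_euclideanSpace_fin] at hScard hS'card
  -- With this threshold each tail is `exp (-8 (m + n))`, against at most `5 ^ (m + n) ≤ exp (7 (m +
  -- n))` pairs of net points. Passing from the nets to all vectors costs a factor 4, hence the 16.
  set s : ℝ := 4 * B * √((m + n : ℕ) : ℝ) with hs
  have hs0 : 0 ≤ s := by positivity
  set A : EuclideanSpace ℝ (Fin m) × EuclideanSpace ℝ (Fin n) → Set (α × (Fin m × Fin n → ℝ)) :=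
    fun w => {z | s ≤ ∑ i, ∑ t, W (i, t) z.1 z.2 * (w.1 i * w.2 t)} with hA
  have hAmeas : ∀ w, MeasurableSet (A w) := fun w =>
    measurableSet_le measurable_const (Finset.measurable_sum _ fun i _ =>
      Finset.measurable_sum _ fun t _ => (hW (i, t)).mul_const _)
  have hAP : ∀ w ∈ S ×ˢ S', P ((fun ω => (F ω, e ω)) ⁻¹' A w) ≤
      ENNReal.ofReal (Real.exp (-s ^ 2 / (2 * B ^ 2))) := by
    intro w hw
    rw [Finset.mem_product] at hw
    -- Disintegrating the joint law over `F` reduces the tail bound to the conditional law, where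
    -- the entries are independent.
    rw [← Measure.map_apply (hF.prodMk he) (hAmeas w), ← compProd_map_condDistrib he.aemeasurable,
      Measure.compProd_apply (hAmeas w)]
    have := Measure.isProbabilityMeasure_map (μ := P) hF.aemeasurable
    calc _ ≤ ∫⁻ _x, ENNReal.ofReal (Real.exp (-s ^ 2 / (2 * B ^ 2))) ∂(P.map F) := by
          refine lintegral_mono_ae ?_
          filter_upwards [hind, ae_all_iff.2 hmean] with x hx1 hx2
          exact measure_bilin_ge_le hB (fun p => (hW p).comp measurable_prodMk_left) hx1
            (fun p y => hWB p x y) hx2 w.1 w.2 (hS1 _ hw.1) (hS'1 _ hw.2) hs0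
      _ = _ := by simp
  have hsub : {ω | ¬ BilinBound (fun i t => W (i, t) (F ω) (e ω))
      (16 * B * √((m + n : ℕ) : ℝ))} ⊆ ⋃ w ∈ S ×ˢ S', (fun ω => (F ω, e ω)) ⁻¹' A w := by
    intro ω hω
    by_contra hcon
    apply hω
    have h4 : 16 * B * √((m + n : ℕ) : ℝ) = 4 * s := by rw [hs]; ring
    rw [h4]
    refine bilinBound_of_half_net (s := (S : Set _)) (s' := (S' : Set _)) hs0 hS hS' ?_
    intro u hu v hv
    by_contra hlt
    exact hcon (Set.mem_biUnion (Finset.mem_product.2 ⟨hu, hv⟩ : (u, v) ∈ S ×ˢ S')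
      (not_le.1 hlt).le)
  have hexp : -s ^ 2 / (2 * B ^ 2) = -8 * ((m + n : ℕ) : ℝ) := by
    rw [hs, mul_pow, mul_pow, Real.sq_sqrt (Nat.cast_nonneg _)]
    field_simp
    ring
  have h5 : ((5 ^ m * 5 ^ n : ℕ) : ℝ) * Real.exp (-s ^ 2 / (2 * B ^ 2)) ≤
      Real.exp (-((m + n : ℕ) : ℝ)) := by
    have h6 : (5 : ℝ) ≤ Real.exp 7 := by linarith [Real.add_one_le_exp (7 : ℝ)]
    have h7 : ((5 ^ m * 5 ^ n : ℕ) : ℝ) ≤ Real.exp (7 * ((m + n : ℕ) : ℝ)) := by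
      rw [← pow_add, mul_comm, Real.exp_nat_mul]
      push_cast
      gcongr
    calc _ ≤ Real.exp (7 * ((m + n : ℕ) : ℝ)) * Real.exp (-s ^ 2 / (2 * B ^ 2)) := by gcongr
      _ = _ := by rw [hexp, ← Real.exp_add]; ring_nf
  calc _ ≤ P (⋃ w ∈ S ×ˢ S', (fun ω => (F ω, e ω)) ⁻¹' A w) := measure_mono hsub
    _ ≤ ∑ w ∈ S ×ˢ S', P ((fun ω => (F ω, e ω)) ⁻¹' A w) := measure_biUnion_finset_le _ _
    _ ≤ ∑ _w ∈ S ×ˢ S', ENNReal.ofReal (Real.exp (-s ^ 2 / (2 * B ^ 2))) :=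
        Finset.sum_le_sum hAP
    _ = ((S ×ˢ S').card : ENNReal) * ENNReal.ofReal (Real.exp (-s ^ 2 / (2 * B ^ 2))) := by
        rw [Finset.sum_const, nsmul_eq_mul]
    _ ≤ ((5 ^ m * 5 ^ n : ℕ) : ENNReal) * ENNReal.ofReal (Real.exp (-s ^ 2 / (2 * B ^ 2))) := by
        gcongr
        rw [Finset.card_product]
        exact Nat.mul_le_mul hScard hS'card
    _ = ENNReal.ofReal (((5 ^ m * 5 ^ n : ℕ) : ℝ) * Real.exp (-s ^ 2 / (2 * B ^ 2))) := by
        rw [ENNReal.ofReal_mul (Nat.cast_nonneg _), ENNReal.ofReal_natCast]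
    _ ≤ _ := ENNReal.ofReal_le_ofReal h5

end Concentration

/-! ### The score and indicator arrays of the errors. -/

section Density

lemma measurable_huberScore (τ : ℝ) : Measurable (huberScore τ) := by
  unfold huberScore; fun_prop

/-- The score is odd and the density even, so reflection turns the integral into its negative. -/
lemma integral_huberScore_eq_zero {τ : ℝ} (hτ : 0 ≤ τ) {h : ℝ → ℝ} (hc : Continuous h)
    (hsymm : ∀ u, h (-u) = h u) :
    ∫ u, huberScore τ u ∂(volume.withDensity fun u => ENNReal.ofReal (h u)) = 0 := by
  rw [integral_withDensity_eq_integral_toReal_smul (by fun_prop)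
    (ae_of_all _ fun _ => ENNReal.ofReal_lt_top)]
  have h1 := integral_neg_eq_self
    (fun u => (ENNReal.ofReal (h u)).toReal • huberScore τ u) volume
  simp only [hsymm, huberScore_neg hτ, smul_neg, integral_neg] at h1
  linarith

lemma le_withDensity_Icc {h : ℝ → ℝ} {a c : ℝ} (hc : ∀ u ∈ Set.Icc (-a) a, c < h u) :
    ENNReal.ofReal c * ENNReal.ofReal (2 * a) ≤
      (volume.withDensity fun u => ENNReal.ofReal (h u)) (Set.Icc (-a) a) := by
  rw [withDensity_apply _ measurableSet_Icc]
  calc _ = ∫⁻ _u in Set.Icc (-a) a, ENNReal.ofReal c := by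
        rw [setLIntegral_const, Real.volume_Icc]
        ring_nf
    _ ≤ _ := setLIntegral_mono' measurableSet_Icc fun u hu =>
        ENNReal.ofReal_le_ofReal (hc u hu).le

end Density

/-- The indicator of the event that an error lies in the quadratic zone of the loss. -/
noncomputable def centralIndicator (τ : ℝ) : ℝ → ℝ := Set.indicator {y | |y| ≤ τ / 2} 1

lemma measurable_centralIndicator (τ : ℝ) : Measurable (centralIndicator τ) :=
  measurable_one.indicator (measurableSet_le measurable_norm measurable_const)

lemma centralIndicator_mem (τ y : ℝ) : 0 ≤ centralIndicator τ y ∧ centralIndicator τ y ≤ 1 := by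
  unfold centralIndicator Set.indicator
  split_ifs <;> simp

section ErrorArrays

variable {Ω α : Type*} [MeasurableSpace Ω] [MeasurableSpace α] {m n : ℕ} {P : Measure Ω}
  [IsProbabilityMeasure P] {F : Ω → α} {e : Ω → Fin m × Fin n → ℝ} {τ : ℝ}

/-- The constant `τ + 1` dominates both the score and the centred indicator, so one bound serves
both arrays. -/
lemma measure_not_bilinBound_score_le (hF : Measurable F) (he : Measurable e) (hτ : 0 < τ)
    (hind : ∀ᵐ x ∂(P.map F), iIndepFun (fun (p : Fin m × Fin n) (y : Fin m × Fin n → ℝ) => y p)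
      (condDistrib e F P x))
    {f : Fin m × Fin n → α → ℝ → ℝ}
    (hdens : ∀ p, ∀ᵐ x ∂(P.map F), (condDistrib e F P x).map (fun y => y p) =
      volume.withDensity fun u => ENNReal.ofReal (f p x u))
    (hcont : ∀ p, ∀ᵐ x ∂(P.map F), Continuous (f p x))
    (hsymm : ∀ p, ∀ᵐ x ∂(P.map F), ∀ u, f p x (-u) = f p x u) :
    P {ω | ¬ BilinBound (fun i t => huberScore τ (e ω (i, t)))
      (16 * (τ + 1) * √((m + n : ℕ) : ℝ))} ≤ ENNReal.ofReal (Real.exp (-((m + n : ℕ) : ℝ))) := by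
  refine measure_not_bilinBound_le hF he (W := fun p _ y => huberScore τ (y p)) ?_
    (by positivity) ?_ ?_ ?_
  · intro p
    exact (measurable_huberScore τ).comp ((measurable_pi_apply p).comp measurable_snd)
  · intro p x y
    linarith [abs_huberScore_le hτ.le (y p)]
  · filter_upwards [hind] with x hx
    exact hx.comp (fun _ => huberScore τ) fun _ => measurable_huberScore τ
  · intro p
    filter_upwards [hdens p, hcont p, hsymm p] with x h1 h2 h3
    rw [← integral_huberScore_eq_zero hτ.le h2 h3, ← h1,
      integral_map (measurable_pi_apply p).aemeasurable
        (measurable_huberScore τ).aestronglyMeasurable]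

/-- The conditional probability that an error lies in the quadratic zone of the loss. -/
noncomputable def centralProb (P : Measure Ω) [IsFiniteMeasure P] (F : Ω → α)
    (e : Ω → Fin m × Fin n → ℝ) (τ : ℝ) (p : Fin m × Fin n) (x : α) : ℝ :=
  (condDistrib e F P x).real {y | |y p| ≤ τ / 2}

lemma measurableSet_abs_apply_le (p : Fin m × Fin n) (c : ℝ) :
    MeasurableSet {y : Fin m × Fin n → ℝ | |y p| ≤ c} :=
  measurableSet_le ((measurable_pi_apply p).abs) measurable_const

lemma measure_not_bilinBound_indicator_le (hF : Measurable F) (he : Measurable e) (hτ : 0 < τ)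
    (hind : ∀ᵐ x ∂(P.map F), iIndepFun (fun (p : Fin m × Fin n) (y : Fin m × Fin n → ℝ) => y p)
      (condDistrib e F P x)) :
    P {ω | ¬ BilinBound (fun i t => centralIndicator τ (e ω (i, t)) -
        centralProb P F e τ (i, t) (F ω))
      (16 * (τ + 1) * √((m + n : ℕ) : ℝ))} ≤ ENNReal.ofReal (Real.exp (-((m + n : ℕ) : ℝ))) := by
  have hq : ∀ p x, 0 ≤ centralProb P F e τ p x ∧ centralProb P F e τ p x ≤ 1 := fun p x =>
    ⟨measureReal_nonneg, measureReal_le_one⟩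
  refine measure_not_bilinBound_le hF he
    (W := fun p x y => centralIndicator τ (y p) - centralProb P F e τ p x) ?_
    (by positivity) ?_ ?_ ?_
  · intro p
    refine ((measurable_centralIndicator τ).comp
      ((measurable_pi_apply p).comp measurable_snd)).sub ?_
    exact ((Kernel.measurable_coe _ (measurableSet_abs_apply_le p (τ / 2))).ennreal_toReal).comp
      measurable_fst
  · intro p x y
    have h1 := centralIndicator_mem τ (y p)
    have h2 := hq p x
    rw [abs_le]
    constructor <;> linarith [h1.1, h1.2, h2.1, h2.2]
  · filter_upwards [hind] with x hx
    exact hx.comp (fun p y => centralIndicator τ y - centralProb P F e τ p x)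
      fun p => (measurable_centralIndicator τ).sub_const _
  · intro p
    refine ae_of_all _ fun x => ?_
    have h1 : (fun y : Fin m × Fin n → ℝ => centralIndicator τ (y p)) =
        Set.indicator {y | |y p| ≤ τ / 2} 1 := rfl
    have hmeas := measurableSet_abs_apply_le (m := m) (n := n) p (τ / 2)
    rw [integral_sub, h1, integral_indicator_one hmeas]
    · simp [centralProb]
    · rw [h1]
      exact (integrable_const (1 : ℝ)).indicator hmeas
    · exact integrable_const _

/-- This keeps the average curvature of the loss uniformly positive: density at least `c` on an
interval of length `τ`. -/
lemma le_centralProb {f : ℝ → ℝ} {p : Fin m × Fin n} {x : α} {c : ℝ} (hc : 0 < c)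
    (hdens : (condDistrib e F P x).map (fun y => y p) =
      volume.withDensity fun u => ENNReal.ofReal (f u))
    (hf : ∀ u ∈ Set.Icc (-(τ / 2)) (τ / 2), c < f u) : c * τ ≤ centralProb P F e τ p x := by
  have h1 := le_withDensity_Icc hf
  rw [← hdens, Measure.map_apply (measurable_pi_apply p) measurableSet_Icc,
    ← ENNReal.ofReal_mul hc.le] at h1
  have h2 : (fun y : Fin m × Fin n → ℝ => y p) ⁻¹' Set.Icc (-(τ / 2)) (τ / 2) =
      {y | |y p| ≤ τ / 2} := by
    ext y
    exact abs_le.symm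
  rw [h2, mul_div_cancel₀ τ two_ne_zero] at h1
  exact (ENNReal.ofReal_le_iff_le_toReal (measure_ne_top _ _)).1 h1

end ErrorArrays

/-! ### The deterministic estimation bound. -/

section Estimator

open scoped Matrix Matrix.Norms.Frobenius

lemma abs_sum_mul_le {r : ℕ} {β : ℝ} (hβ : 0 ≤ β) {x y : Fin r → ℝ} (hx : ∀ j, |x j| ≤ β)
    (hy : ∀ j, |y j| ≤ β) : |∑ j, x j * y j| ≤ r * β ^ 2 := by
  calc _ ≤ ∑ j, |x j * y j| := Finset.abs_sum_le_sum_abs _ _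
    _ ≤ ∑ _j : Fin r, β ^ 2 := by
        refine Finset.sum_le_sum fun j _ => ?_
        rw [abs_mul, sq]
        exact mul_le_mul (hx j) (hy j) (abs_nonneg _) hβ
    _ = _ := by simp

/-- The rate of the common component on the event that the score and the indicator arrays have
small operator norm. -/
lemma norm_common_component_sub_le {r N T : ℕ} {τ β p₀ K : ℝ} (hτ : 0 < τ) (hβ : 0 ≤ β)
    (hp₀ : 0 < p₀) (hK : 0 ≤ K) {𝓛 𝓕 : Set (Fin r → ℝ)} (h𝓛 : ∀ l ∈ 𝓛, ∀ j, |l j| ≤ β)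
    (h𝓕 : ∀ l ∈ 𝓕, ∀ j, |l j| ≤ β)
    {θ θ₀ : Matrix (Fin N) (Fin r) ℝ × Matrix (Fin T) (Fin r) ℝ} {e : Fin N × Fin T → ℝ}
    (hN : 0 < N) (hT : 0 < T)
    (hθ₀ : θ₀ ∈ paramSet 𝓛 𝓕 N T)
    (hθ : IsHuberMinimizer τ 𝓛 𝓕 (observations θ₀.1 θ₀.2 e) θ) {p : Fin N → Fin T → ℝ}
    (hp : ∀ i t, p₀ ≤ p i t) (hΨ : BilinBound (fun i t => huberScore τ (e (i, t))) K)
    (hG : BilinBound (fun i t => centralIndicator τ (e (i, t)) - p i t) K) :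
    ‖θ.1 * θ.2ᵀ - θ₀.1 * θ₀.2ᵀ‖ ≤
      ((2 * r : ℝ) + τ / (4 * (τ + 2 * r * β ^ 2)) * ((2 * r) ^ 2 * (τ + 2 * r * β ^ 2))) * K /
        (τ / (4 * (τ + 2 * r * β ^ 2)) * p₀) := by
  -- `2 * r * β ^ 2` bounds the entries of `δ`; the extra `τ` ensures `τ ≤ D`, as the curvature
  -- estimate requires.
  set D := τ + 2 * r * β ^ 2 with hD
  have hD0 : 0 < D := by positivity
  have hτD : τ ≤ D := le_add_of_nonneg_right (by positivity)
  set δ : Fin N → Fin T → ℝ := fun i t => ∑ j, θ.1 i j * θ.2 t j - ∑ j, θ₀.1 i j * θ₀.2 t j with hδ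
  have hδ' : ∀ i t, (θ.1 * θ.2ᵀ - θ₀.1 * θ₀.2ᵀ) i t = δ i t := by
    intro i t
    simp [hδ, Matrix.mul_apply]
  have hnorm : ‖θ.1 * θ.2ᵀ - θ₀.1 * θ₀.2ᵀ‖ = √(∑ i, ∑ t, δ i t ^ 2) := by
    rw [← Real.sqrt_sq (norm_nonneg _), frobenius_norm_sq]
    simp only [frobSq, hδ']
  rw [hnorm]
  have hδD : ∀ i t, |δ i t| ≤ D := by
    intro i t
    have h1 := abs_sum_mul_le hβ (h𝓛 _ (hθ.1.1 i)) (h𝓕 _ (hθ.1.2.1 t))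
    have h2 := abs_sum_mul_le hβ (h𝓛 _ (hθ₀.1 i)) (h𝓕 _ (hθ₀.2.1 t))
    have h3 := abs_sub (∑ j, θ.1 i j * θ.2 t j) (∑ j, θ₀.1 i j * θ₀.2 t j)
    simp only [hδ]
    linarith
  have hloss : ∑ i, ∑ t, (-huberScore τ (e (i, t)) * δ i t +
      τ / (4 * D) * (centralIndicator τ (e (i, t)) * δ i t ^ 2)) ≤ 0 := by
    have h1 : huberObjective τ (observations θ₀.1 θ₀.2 e) θ ≤
        huberObjective τ (observations θ₀.1 θ₀.2 e) θ₀ := hθ.2 hθ₀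
    have hpos : (0 : ℝ) < ((T : ℝ) * (N : ℝ))⁻¹ := by positivity
    have h2 := le_of_mul_le_mul_left h1 hpos
    rw [Finset.sum_comm, Finset.sum_comm (s := (Finset.univ : Finset (Fin T)))] at h2
    have h3 : ∀ i t, observations θ₀.1 θ₀.2 e i t - ∑ j, θ.1 i j * θ.2 t j =
        e (i, t) - δ i t := by
      intro i t
      simp only [observations, Matrix.of_apply, hδ]
      ring
    have h4 : ∀ i t, observations θ₀.1 θ₀.2 e i t - ∑ j, θ₀.1 i j * θ₀.2 t j = e (i, t) := by
      intro i t
      simp only [observations, Matrix.of_apply]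
      ring
    simp only [h3, h4] at h2
    calc _ ≤ ∑ i, ∑ t, (huberLoss τ (e (i, t) - δ i t) - huberLoss τ (e (i, t))) := by
          refine Finset.sum_le_sum fun i _ => Finset.sum_le_sum fun t _ => ?_
          unfold centralIndicator Set.indicator
          split_ifs with h
          · rw [Pi.one_apply, one_mul]
            exact huberLoss_sub_ge_of_abs_le hτ h (hδD i t) hτD
          · rw [zero_mul, mul_zero, add_zero]
            exact huberLoss_sub_ge hτ.le _ _
      _ ≤ 0 := by
          simp only [Finset.sum_sub_distrib]
          linarith
  -- The index type `Fin r ⊕ Fin r` writes `δ` as `2r` rank-one arrays, with the sign of the true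
  -- part put into the loadings.
  have hfin := sqrt_sum_sq_le_of_loss_le (κ := Fin r ⊕ Fin r) hK
    (by positivity : 0 < τ / (4 * D)) hp₀ hD0.le hp hΨ hG
    (Sum.elim (fun j i => θ.1 i j) fun j i => -θ₀.1 i j)
    (Sum.elim (fun j t => θ.2 t j) fun j t => θ₀.2 t j) (by
      intro i t
      simp [hδ, sub_eq_add_neg]) hδD hloss
  have hcard : ((Fintype.card (Fin r ⊕ Fin r) : ℕ) : ℝ) = 2 * r := by
    rw [Fintype.card_sum, Fintype.card_fin]
    push_cast
    ring
  rwa [hcard] at hfin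

lemma inv_sqrt_mul_inv_sqrt (n : ℕ) : (√(n : ℝ))⁻¹ * (√(n : ℝ))⁻¹ = (n : ℝ)⁻¹ := by
  rw [← mul_inv, Real.mul_self_sqrt (Nat.cast_nonneg n)]

lemma scaled_transpose_mul_scaled {r n : ℕ} (A B : Matrix (Fin n) (Fin r) ℝ) :
    ((√(n : ℝ))⁻¹ • A)ᵀ * ((√(n : ℝ))⁻¹ • B) = (n : ℝ)⁻¹ • (Aᵀ * B) := by
  rw [Matrix.transpose_smul, Matrix.smul_mul, Matrix.mul_smul, smul_smul, inv_sqrt_mul_inv_sqrt]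

lemma norm_scaled_sq {r n : ℕ} (A : Matrix (Fin n) (Fin r) ℝ) :
    ‖(√(n : ℝ))⁻¹ • A‖ ^ 2 = 1 / (n : ℝ) * frobSq A := by
  rw [norm_smul, mul_pow, frobenius_norm_sq, Real.norm_eq_abs, sq_abs, sq,
    inv_sqrt_mul_inv_sqrt, one_div]

lemma norm_scaled_le {r n : ℕ} {A : Matrix (Fin n) (Fin r) ℝ} {β : ℝ} (hn : 0 < n)
    (hA : ∀ i j, |A i j| ≤ β) : ‖(√(n : ℝ))⁻¹ • A‖ ≤ √(r * β ^ 2) := by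
  apply Real.le_sqrt_of_sq_le
  rw [norm_scaled_sq, one_div, inv_mul_le_iff₀ (by positivity)]
  calc frobSq A ≤ ∑ _i : Fin n, ∑ _j : Fin r, β ^ 2 := by
        refine Finset.sum_le_sum fun i _ => Finset.sum_le_sum fun j _ => ?_
        rw [← sq_abs]
        exact pow_le_pow_left₀ (abs_nonneg _) (hA i j) 2
    _ = _ := by simp

/-- This turns the scale `√(N + T)` of the random arrays into the stated rate, as `1/N + 1/T ≤ 2 /
min N T`. -/
lemma sqrt_add_div_le {N T : ℕ} (hN : 0 < N) (hT : 0 < T) :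
    (√(N : ℝ))⁻¹ * (√(T : ℝ))⁻¹ * √((N + T : ℕ) : ℝ) ≤ √(2 / ((min N T : ℕ) : ℝ)) := by
  apply Real.le_sqrt_of_sq_le
  rw [mul_pow, mul_pow, Real.sq_sqrt (Nat.cast_nonneg _), inv_pow, inv_pow,
    Real.sq_sqrt (Nat.cast_nonneg _), Real.sq_sqrt (Nat.cast_nonneg _)]
  have hm : 0 < min N T := lt_min hN hT
  rw [← mul_inv, inv_mul_eq_div, div_le_div_iff₀ (by positivity) (by positivity)]
  have h1 : (N + T) * min N T ≤ 2 * (N * T) := by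
    have h2 : N * min N T ≤ N * T := Nat.mul_le_mul_left _ (min_le_right _ _)
    have h3 : T * min N T ≤ T * N := Nat.mul_le_mul_left _ (min_le_left _ _)
    nlinarith
  exact_mod_cast h1

/-- The deterministic core: on the event that the random arrays have operator norm of order
`√(N + T)` and the true factors have a well-separated Gram matrix, every minimizer is within the
stated rate of the sign-aligned true parameter. -/
theorem exists_estimation_bound (r : ℕ) {τ β p₀ B σ : ℝ} (hτ : 0 < τ) (hβ : 0 ≤ β) (hp₀ : 0 < p₀)
    (hB : 0 ≤ B) (hσ : 0 < σ) : ∃ (M : ℝ) (n₀ : ℕ), 0 < M ∧ ∀ {N T : ℕ} {𝓛 𝓕 : Set (Fin r → ℝ)}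
      {θ θ₀ : Matrix (Fin N) (Fin r) ℝ × Matrix (Fin T) (Fin r) ℝ} {e : Fin N × Fin T → ℝ}
      {p : Fin N → Fin T → ℝ}, (∀ l ∈ 𝓛, ∀ j, |l j| ≤ β) → (∀ l ∈ 𝓕, ∀ j, |l j| ≤ β) →
      n₀ ≤ N → n₀ ≤ T → θ₀ ∈ paramSet 𝓛 𝓕 N T →
      IsHuberMinimizer τ 𝓛 𝓕 (observations θ₀.1 θ₀.2 e) θ → (∀ i t, p₀ ≤ p i t) →
      BilinBound (fun i t => huberScore τ (e (i, t))) (B * √((N + T : ℕ) : ℝ)) →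
      BilinBound (fun i t => centralIndicator τ (e (i, t)) - p i t) (B * √((N + T : ℕ) : ℝ)) →
      (∀ j, σ ≤ gram θ₀.2 j j) → (∀ i j, i < j → σ ≤ gram θ₀.2 i i - gram θ₀.2 j j) →
      (1 / (N : ℝ)) * frobSq (θ.1 - θ₀.1 * signMatrix θ.2 θ₀.2) ≤ M * (1 / ((min N T : ℕ) : ℝ)) ∧
      (1 / (T : ℝ)) * frobSq (θ.2 - θ₀.2 * signMatrix θ.2 θ₀.2) ≤
        M * (1 / ((min N T : ℕ) : ℝ)) := by
  obtain ⟨C, η₀, hC, hη₀, hpert⟩ :=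
    exists_factor_perturbation_bound r (Real.sqrt_nonneg (r * β ^ 2)) hσ hσ
  set D := τ + 2 * r * β ^ 2 with hD
  have hD0 : 0 < D := by positivity
  set c := ((2 * r : ℝ) + τ / (4 * D) * ((2 * r) ^ 2 * D)) * B / (τ / (4 * D) * p₀) with hc
  have hc0 : 0 ≤ c := by positivity
  obtain ⟨n₀, hn₀⟩ := exists_nat_gt (2 * c ^ 2 / η₀ ^ 2)
  -- The added `1` keeps the constant positive when `c = 0`, for instance when `r = 0`; `n₀ + 1`
  -- makes the sample sizes nonzero.
  refine ⟨2 * (C * c) ^ 2 + 1, n₀ + 1, by positivity, ?_⟩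
  intro N T 𝓛 𝓕 θ θ₀ e p h𝓛 h𝓕 hN hT hθ₀ hθ hp hΨ hG hdiag hgap
  have hN0 : 0 < N := by omega
  have hT0 : 0 < T := by omega
  have hmin0 : 0 < min N T := lt_min hN0 hT0
  have hcc := norm_common_component_sub_le hτ hβ hp₀ (by positivity) h𝓛 h𝓕 hN0 hT0 hθ₀ hθ hp hΨ hG
  have hcc' : ‖θ.1 * θ.2ᵀ - θ₀.1 * θ₀.2ᵀ‖ ≤ c * √((N + T : ℕ) : ℝ) := by
    refine hcc.trans (le_of_eq ?_)
    rw [hc]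
    ring
  set η := c * √(2 / ((min N T : ℕ) : ℝ)) with hη
  obtain ⟨d, -, hd, hgd⟩ := hθ.1.2.2.2
  obtain ⟨d₀, -, -, hgd₀⟩ := hθ₀.2.2.2
  have hd₀ : ∀ j, gram θ₀.2 j j = d₀ j := fun j => by rw [hgd₀, Matrix.diagonal_apply_eq]
  have hEη : ‖((√(N : ℝ))⁻¹ • θ.1) * ((√(T : ℝ))⁻¹ • θ.2)ᵀ -
      ((√(N : ℝ))⁻¹ • θ₀.1) * ((√(T : ℝ))⁻¹ • θ₀.2)ᵀ‖ ≤ η := by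
    simp only [Matrix.transpose_smul, Matrix.smul_mul, Matrix.mul_smul, smul_smul]
    rw [← smul_sub, norm_smul, Real.norm_of_nonneg (by positivity)]
    calc _ ≤ (√(T : ℝ))⁻¹ * (√(N : ℝ))⁻¹ * (c * √((N + T : ℕ) : ℝ)) := by
          gcongr
      _ = c * ((√(N : ℝ))⁻¹ * (√(T : ℝ))⁻¹ * √((N + T : ℕ) : ℝ)) := by ring
      _ ≤ η := mul_le_mul_of_nonneg_left (sqrt_add_div_le hN0 hT0) hc0
  have hηη₀ : η ≤ η₀ := by
    apply le_of_sq_le_sq _ hη₀.le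
    rw [hη, mul_pow, Real.sq_sqrt (by positivity)]
    have h1 : (n₀ : ℝ) ≤ ((min N T : ℕ) : ℝ) := by
      exact_mod_cast le_min (by omega : n₀ ≤ N) (by omega : n₀ ≤ T)
    have h2 : 2 * c ^ 2 / η₀ ^ 2 < ((min N T : ℕ) : ℝ) := lt_of_lt_of_le hn₀ h1
    rw [div_lt_iff₀ (by positivity)] at h2
    rw [mul_div_assoc', div_le_iff₀ (by positivity)]
    linarith
  set s : Fin r → ℝ := fun j => if 0 ≤ ((T : ℝ)⁻¹ • (θ.2ᵀ * θ₀.2)) j j then (1 : ℝ) else -1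
    with hs
  have hsign : signMatrix θ.2 θ₀.2 = Matrix.diagonal s := rfl
  -- Dividing by `√N` and `√T` turns the constraints of the parameter set into `Uᵀ U = 1` and `Gᵀ G`
  -- diagonal.
  obtain ⟨h1, h2⟩ := hpert (U := (√(N : ℝ))⁻¹ • θ.1) (U₀ := (√(N : ℝ))⁻¹ • θ₀.1)
    (G := (√(T : ℝ))⁻¹ • θ.2) (G₀ := (√(T : ℝ))⁻¹ • θ₀.2) (d := d) (d₀ := d₀)
    (by rw [scaled_transpose_mul_scaled]; exact hθ.1.2.2.1)
    (by rw [scaled_transpose_mul_scaled]; exact hθ₀.2.2.1)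
    (by rw [scaled_transpose_mul_scaled]; exact hgd)
    (by rw [scaled_transpose_mul_scaled]; exact hgd₀)
    (norm_scaled_le hT0 fun t => h𝓕 _ (hθ.1.2.1 t))
    (norm_scaled_le hT0 fun t => h𝓕 _ (hθ₀.2.1 t)) hd
    (fun j => by rw [← hd₀]; exact hdiag j)
    (fun i j hij => by rw [← hd₀, ← hd₀]; exact hgap i j hij) hEη hηη₀ s
    (fun k => by rw [scaled_transpose_mul_scaled])
  have hrate : (C * η) ^ 2 ≤ (2 * (C * c) ^ 2 + 1) * (1 / ((min N T : ℕ) : ℝ)) := by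
    rw [hη, ← mul_assoc, mul_pow, Real.sq_sqrt (by positivity), add_mul]
    have : (0 : ℝ) ≤ 1 * (1 / ((min N T : ℕ) : ℝ)) := by positivity
    refine le_add_of_le_of_nonneg (le_of_eq ?_) this
    ring
  rw [hsign]
  constructor
  · rw [← norm_scaled_sq, smul_sub, ← Matrix.smul_mul]
    exact (pow_le_pow_left₀ (norm_nonneg _) h1 2).trans hrate
  · rw [← norm_scaled_sq, smul_sub, ← Matrix.smul_mul]
    exact (pow_le_pow_left₀ (norm_nonneg _) h2 2).trans hrate

end Estimator

/-! ### Uniform constants and passage to probability. -/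

lemma exists_abs_coord_le {r : ℕ} {S : Set (Fin r → ℝ)} (hS : IsCompact S) :
    ∃ β : ℝ, ∀ x ∈ S, ∀ j, |x j| ≤ β := by
  obtain ⟨β, hβ⟩ := hS.isBounded.exists_norm_le
  exact ⟨β, fun x hx j => (norm_le_pi_norm x j).trans (hβ x hx)⟩

lemma exists_separation {r : ℕ} {σ₀ : Fin r → ℝ} (hpos : ∀ j, 0 < σ₀ j) (hanti : StrictAnti σ₀) :
    ∃ ρ : ℝ, 0 < ρ ∧ (∀ j, ρ ≤ σ₀ j) ∧ ∀ i j, i < j → ρ ≤ σ₀ i - σ₀ j := by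
  have h1 : ∀ᶠ ρ in 𝓝[>] (0 : ℝ), ∀ j, ρ ≤ σ₀ j :=
    eventually_all.2 fun j => eventually_nhdsWithin_of_eventually_nhds (eventually_le_nhds (hpos j))
  have h2 : ∀ᶠ ρ in 𝓝[>] (0 : ℝ), ∀ i j, i < j → ρ ≤ σ₀ i - σ₀ j := by
    refine eventually_all.2 fun i => eventually_all.2 fun j => ?_
    by_cases hij : i < j
    · filter_upwards [eventually_nhdsWithin_of_eventually_nhds
        (eventually_le_nhds (sub_pos.2 (hanti hij)))] with ρ hρ _
      exact hρ
    · exact Eventually.of_forall fun _ h => absurd h hij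
  obtain ⟨ρ, ⟨h3, h4⟩, h5⟩ := ((h1.and h2).and self_mem_nhdsWithin).exists
  exact ⟨ρ, h5, h3, h4⟩

lemma gram_separation {r T : ℕ} {σ₀ : Fin r → ℝ} {ρ : ℝ} (hρ : ∀ j, ρ ≤ σ₀ j)
    (hgap : ∀ i j, i < j → ρ ≤ σ₀ i - σ₀ j) {F : Matrix (Fin T) (Fin r) ℝ}
    (hF : ∀ j, |gram F j j - σ₀ j| < ρ / 4) :
    (∀ j, ρ / 2 ≤ gram F j j) ∧ ∀ i j, i < j → ρ / 2 ≤ gram F i i - gram F j j := by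
  have h : ∀ j, -(ρ / 4) < gram F j j - σ₀ j ∧ gram F j j - σ₀ j < ρ / 4 := fun j => abs_lt.1 (hF j)
  constructor
  · intro j
    linarith [hρ j, (h j).1, (h j).2]
  · intro i j hij
    linarith [hgap i j hij, (h i).1, (h j).2]

/-- A family of random variables which is bounded by `M a_k` off sets of vanishing probability is
`O_p(a_k)`. -/
lemma IsBigOInProb.of_tendsto {Ω : ℕ → Type*} [∀ k, MeasurableSpace (Ω k)] {P : ∀ k, Measure (Ω k)}
    {X : ∀ k, Ω k → ℝ} {a : ℕ → ℝ} {M : ℝ} (hM : 0 < M) {E : ∀ k, Set (Ω k)}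
    (hE : Tendsto (fun k => P k (E k)) atTop (𝓝 0))
    (h : ∀ᶠ k in atTop, ∀ ω, ω ∉ E k → |X k ω| ≤ M * a k) : IsBigOInProb P X a := by
  intro δ hδ
  refine ⟨M, hM, ?_⟩
  filter_upwards [hE.eventually_le_const (ENNReal.ofReal_pos.2 hδ), h] with k h1 h2
  refine (measure_mono fun ω hω => ?_).trans h1
  by_contra hcon
  exact not_lt.2 (h2 ω hcon) hω

end HuberFactor

open HuberFactor in
theorem theorem3p1 {r : ℕ} (τ : ℝ) (hτ : 0 < τ)
    -- sample sizes, both tending to infinity in an arbitrary manner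
    (N T : ℕ → ℕ) (hN : Tendsto N atTop atTop) (hT : Tendsto T atTop atTop)
    {Ω : ℕ → Type*} [∀ k, MeasurableSpace (Ω k)]
    (P : ∀ k, Measure (Ω k)) [∀ k, IsProbabilityMeasure (P k)]
    -- true loadings, factors and errors
    (L₀ : ∀ k, Matrix (Fin (N k)) (Fin r) ℝ)
    (F₀ : ∀ k, Ω k → Matrix (Fin (T k)) (Fin r) ℝ) (hF₀ : ∀ k, Measurable (F₀ k))
    (ε : ∀ k, Ω k → Fin (N k) × Fin (T k) → ℝ) (hε : ∀ k, Measurable (ε k))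
    -- compactness, identifiability of the true parameter, strong factors
    (𝓛 𝓕 : Set (Fin r → ℝ)) (h𝓛 : IsCompact 𝓛) (h𝓕 : IsCompact 𝓕)
    (hθ₀ : ∀ k, ∀ᵐ ω ∂(P k), (L₀ k, F₀ k ω) ∈ HuberFactor.paramSet 𝓛 𝓕 (N k) (T k))
    (σ₀ : Fin r → ℝ) (hσ_pos : ∀ j, 0 < σ₀ j) (hσ_anti : StrictAnti σ₀)
    (hσ : ∀ j, HuberFactor.TendstoInProb P (fun k ω => HuberFactor.gram (F₀ k ω) j j) (σ₀ j))
    -- given the factors, the errors are independent across `i` and `t`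
    (h_indep : ∀ k, ∀ᵐ x ∂((P k).map (F₀ k)),
      iIndepFun (fun (p : Fin (N k) × Fin (T k)) (e : Fin (N k) × Fin (T k) → ℝ) => e p)
        (HuberFactor.condErrorLaw (P k) (F₀ k) (ε k) x))
    -- conditional second moments
    (h_moment : ∀ k p, ∀ᵐ x ∂((P k).map (F₀ k)),
      ∫⁻ e, ENNReal.ofReal (e p ^ 2) ∂(HuberFactor.condErrorLaw (P k) (F₀ k) (ε k) x) < ⊤)
    -- conditional densities: `f k (i, t) x` is the density of `ε_{it}` given the factor values `x`
    (f : ∀ k, Fin (N k) × Fin (T k) → Matrix (Fin (T k)) (Fin r) ℝ → ℝ → ℝ)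
    (h_density : ∀ k p, ∀ᵐ x ∂((P k).map (F₀ k)),
      (HuberFactor.condErrorLaw (P k) (F₀ k) (ε k) x).map (fun e => e p) =
        volume.withDensity (fun u => ENNReal.ofReal (f k p x u)))
    (h_cont : ∀ k p, ∀ᵐ x ∂((P k).map (F₀ k)), Continuous (f k p x))
    (h_symm : ∀ k p, ∀ᵐ x ∂((P k).map (F₀ k)), ∀ u, f k p x (-u) = f k p x u)
    (h_lower : ∀ C : Set ℝ, IsCompact C → ∃ c : ℝ, 0 < c ∧
      ∀ k p, ∀ᵐ x ∂((P k).map (F₀ k)), ∀ u ∈ C, c < f k p x u)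
    -- the estimator: a minimizer, with probability tending to one
    (Lhat : ∀ k, Ω k → Matrix (Fin (N k)) (Fin r) ℝ)
    (Fhat : ∀ k, Ω k → Matrix (Fin (T k)) (Fin r) ℝ)
    (h_min : Tendsto (fun k => P k {ω | ¬ HuberFactor.IsHuberMinimizer τ 𝓛 𝓕
        (HuberFactor.observations (L₀ k) (F₀ k ω) (ε k ω)) (Lhat k ω, Fhat k ω)})
      atTop (𝓝 0)) :
    HuberFactor.IsBigOInProb P
        (fun k ω => (1 / (N k : ℝ)) * HuberFactor.frobSq
          (Lhat k ω - L₀ k * HuberFactor.signMatrix (Fhat k ω) (F₀ k ω)))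
        (fun k => 1 / ((min (N k) (T k) : ℕ) : ℝ)) ∧
    HuberFactor.IsBigOInProb P
        (fun k ω => (1 / (T k : ℝ)) * HuberFactor.frobSq
          (Fhat k ω - F₀ k ω * HuberFactor.signMatrix (Fhat k ω) (F₀ k ω)))
        (fun k => 1 / ((min (N k) (T k) : ℕ) : ℝ)) := by
  obtain ⟨β₁, hβ₁⟩ := exists_abs_coord_le h𝓛
  obtain ⟨β₂, hβ₂⟩ := exists_abs_coord_le h𝓕
  set β := max 0 (max β₁ β₂)
  have hL : ∀ l ∈ 𝓛, ∀ j, |l j| ≤ β := fun l hl j =>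
    (hβ₁ l hl j).trans ((le_max_left _ _).trans (le_max_right _ _))
  have hF : ∀ l ∈ 𝓕, ∀ j, |l j| ≤ β := fun l hl j =>
    (hβ₂ l hl j).trans ((le_max_right _ _).trans (le_max_right _ _))
  obtain ⟨ρ, hρ0, hρ, hgap⟩ := exists_separation hσ_pos hσ_anti
  -- This compact set is the zone where `centralIndicator` equals one.
  obtain ⟨c, hc0, hc⟩ := h_lower (Set.Icc (-(τ / 2)) (τ / 2)) isCompact_Icc
  obtain ⟨M, n₀, hM, hbound⟩ := exists_estimation_bound r (τ := τ) (β := β) (p₀ := c * τ)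
    (B := 16 * (τ + 1)) (σ := ρ / 2) hτ (le_max_left _ _) (by positivity) (by positivity)
    (by positivity)
  set K : ℕ → ℝ := fun k => 16 * (τ + 1) * √((N k + T k : ℕ) : ℝ) with hK
  -- Off five bad events the deterministic bound applies. They need not be measurable, since only
  -- monotonicity and subadditivity of the outer measure are used on their union.
  set E₁ : ∀ k, Set (Ω k) := fun k => {ω | ¬ IsHuberMinimizer τ 𝓛 𝓕
    (observations (L₀ k) (F₀ k ω) (ε k ω)) (Lhat k ω, Fhat k ω)} with hE₁
  set E₂ : ∀ k, Set (Ω k) := fun k => ⋃ j, {ω | ρ / 4 ≤ |gram (F₀ k ω) j j - σ₀ j|} with hE₂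
  set E₃ : ∀ k, Set (Ω k) := fun k =>
    {ω | ¬ BilinBound (fun i t => huberScore τ (ε k ω (i, t))) (K k)} with hE₃
  set E₄ : ∀ k, Set (Ω k) := fun k =>
    {ω | ¬ BilinBound (fun i t => centralIndicator τ (ε k ω (i, t)) -
      centralProb (P k) (F₀ k) (ε k) τ (i, t) (F₀ k ω)) (K k)} with hE₄
  set E₅ : ∀ k, Set (Ω k) := fun k => {ω | ¬ ((L₀ k, F₀ k ω) ∈ paramSet 𝓛 𝓕 (N k) (T k) ∧
    ∀ p, c * τ ≤ centralProb (P k) (F₀ k) (ε k) τ p (F₀ k ω))} with hE₅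
  have hexp : Tendsto (fun k => ENNReal.ofReal (Real.exp (-((N k + T k : ℕ) : ℝ)))) atTop (𝓝 0) := by
    rw [← ENNReal.ofReal_zero]
    refine ENNReal.tendsto_ofReal (Real.tendsto_exp_neg_atTop_nhds_zero.comp ?_)
    exact tendsto_natCast_atTop_atTop.comp (tendsto_atTop_mono (fun _ => Nat.le_add_right _ _) hN)
  have hP₂ : Tendsto (fun k => P k (E₂ k)) atTop (𝓝 0) := by
    have h1 : Tendsto (fun k => ∑ j, P k {ω | ρ / 4 ≤ |gram (F₀ k ω) j j - σ₀ j|}) atTop (𝓝 0) := by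
      simpa using tendsto_finsetSum (Finset.univ : Finset (Fin r)) fun j _ =>
        hσ j (ρ / 4) (by positivity)
    exact tendsto_of_tendsto_of_tendsto_of_le_of_le tendsto_const_nhds h1 (fun _ => zero_le)
      fun k => measure_iUnion_fintype_le _ _
  have hP₃ : Tendsto (fun k => P k (E₃ k)) atTop (𝓝 0) :=
    tendsto_of_tendsto_of_tendsto_of_le_of_le tendsto_const_nhds hexp (fun _ => zero_le)
      fun k => measure_not_bilinBound_score_le (hF₀ k) (hε k) hτ (h_indep k) (h_density k)
        (h_cont k) (h_symm k)
  have hP₄ : Tendsto (fun k => P k (E₄ k)) atTop (𝓝 0) :=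
    tendsto_of_tendsto_of_tendsto_of_le_of_le tendsto_const_nhds hexp (fun _ => zero_le)
      fun k => measure_not_bilinBound_indicator_le (hF₀ k) (hε k) hτ (h_indep k)
  have hP₅ : ∀ k, P k (E₅ k) = 0 := by
    intro k
    have h1 : ∀ᵐ x ∂((P k).map (F₀ k)), ∀ p,
        c * τ ≤ centralProb (P k) (F₀ k) (ε k) τ p x := by
      filter_upwards [ae_all_iff.2 (h_density k), ae_all_iff.2 (hc k)] with x h1 h2 p
      exact le_centralProb hc0 (h1 p) (h2 p)
    have h2 := ae_of_ae_map (hF₀ k).aemeasurable h1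
    exact ae_iff.1 ((hθ₀ k).and h2)
  have hPE : Tendsto (fun k => P k (E₁ k ∪ E₂ k ∪ E₃ k ∪ E₄ k ∪ E₅ k)) atTop (𝓝 0) := by
    have h1 : Tendsto (fun k => P k (E₁ k) + P k (E₂ k) + P k (E₃ k) + P k (E₄ k) + P k (E₅ k))
        atTop (𝓝 0) := by
      simpa [hP₅] using ((h_min.add hP₂).add hP₃).add hP₄
    refine tendsto_of_tendsto_of_tendsto_of_le_of_le tendsto_const_nhds h1 (fun _ => zero_le)
      fun k => ?_
    refine (measure_union_le _ _).trans (add_le_add_left ?_ _)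
    refine (measure_union_le _ _).trans (add_le_add_left ?_ _)
    refine (measure_union_le _ _).trans (add_le_add_left ?_ _)
    exact measure_union_le _ _
  have hgood : ∀ᶠ k in atTop, ∀ ω, ω ∉ E₁ k ∪ E₂ k ∪ E₃ k ∪ E₄ k ∪ E₅ k →
      (1 / (N k : ℝ)) * frobSq (Lhat k ω - L₀ k * signMatrix (Fhat k ω) (F₀ k ω)) ≤
        M * (1 / ((min (N k) (T k) : ℕ) : ℝ)) ∧
      (1 / (T k : ℝ)) * frobSq (Fhat k ω - F₀ k ω * signMatrix (Fhat k ω) (F₀ k ω)) ≤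
        M * (1 / ((min (N k) (T k) : ℕ) : ℝ)) := by
    filter_upwards [hN.eventually_ge_atTop n₀, hT.eventually_ge_atTop n₀] with k hNk hTk ω hω
    simp only [Set.mem_union, not_or] at hω
    obtain ⟨⟨⟨⟨h1, h2⟩, h3⟩, h4⟩, h5⟩ := hω
    have h1' := not_not.1 h1
    have h3' := not_not.1 h3
    have h4' := not_not.1 h4
    obtain ⟨h5a, h5b⟩ := not_not.1 h5
    have h2' : ∀ j, |gram (F₀ k ω) j j - σ₀ j| < ρ / 4 := fun j =>
      not_le.1 fun h => h2 (Set.mem_iUnion.2 ⟨j, h⟩)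
    obtain ⟨h6, h7⟩ := gram_separation hρ hgap h2'
    exact hbound (θ := (Lhat k ω, Fhat k ω)) (θ₀ := (L₀ k, F₀ k ω)) hL hF hNk hTk h5a h1'
      (fun i t => h5b (i, t)) h3' h4' h6 h7
  have hfrob : ∀ {m n : ℕ} (q : ℕ) (A : Matrix (Fin m) (Fin n) ℝ),
      |1 / (q : ℝ) * frobSq A| = 1 / (q : ℝ) * frobSq A := fun q A =>
    abs_of_nonneg (mul_nonneg (by positivity)
      (Finset.sum_nonneg fun _ _ => Finset.sum_nonneg fun _ _ => sq_nonneg _))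
  constructor
  · refine IsBigOInProb.of_tendsto hM hPE ?_
    filter_upwards [hgood] with k hk ω hω
    rw [hfrob]
    exact (hk ω hω).1
  · refine IsBigOInProb.of_tendsto hM hPE ?_
    filter_upwards [hgood] with k hk ω hω
    rw [hfrob]
    exact (hk ω hω).2
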